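/- **Proposition 5.1.** Let $N\ge 1$, let $\Omega\subset\mathbb{R}^N$ be a nonempty bounded open set, let $K\ge 1$, $n_1,\dots,n_K\in\mathbb{Z}$, and let $a^{ij}$ ($1\le i,j\le N$), $b^i$ ($1\le i\le K$) and $\rho$ be in $C(\overline\Omega)$ with $\rho>0$ on $\overline\Omega$. Suppose that for some $\lambda>0$, $\sum_{i,j}a^{ij}(x)\xi_i\xi_j\ge\lambda|\xi|^2$ for all $x\in\Omega$, $\xi\in\mathbb{R}^N$. Consider the problem $$-\sum_{i,j=1}^N D_i(a^{ij}D_ju)+\sum_{i=1}^K b^iu^{n_i}=0\ \text{ in }\Omega,\qquad u=\rho\ \text{ on }\partial\Omega.\tag{$*$}$$ A *weak solution* of $(*)$ is a function $u\in H^1(\Omega)$ such that $\sum_i b^iu^{n_i}\in L^1_{loc}(\Omega)$, $$\int_\Omega\sum_{i,j}a^{ij}D_ju\,D_i\varphi\,dx+\int_\Omega\Big(\sum_i b^iu^{n_i}\Big)\varphi\,dx=0\qquad\text{for all }\varphi\in C_c^\infty(\Omega),$$ and $u=\rho$ on $\partial\Omega$ in the sense that $u=u_0+w$ with $u_0\in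 H^1_0(\Omega)$ (the closure of $C_c^\infty(\Omega)$ in $H^1(\Omega)$) and some $w\in H^1(\Omega)\cap C(\overline\Omega)$ with $w=\rho$ on $\partial\Omega$. Suppose that some exponent is positive, that $n_K$ is the largest exponent, that $n_i<n_K$ for all $i\ne K$, and that $b^K>0$ on $\overline\Omega$. Consider the following two cases. 1. Some exponent is negative, $n_1$ is the smallest exponent, $n_1<n_i$ for all $i\neq 1$, and $b^1<0$ on $\overline\Omega$. 2. $n_K$ is odd and $n_i>0$ for all $1\le i\le K$. Define, with suprema and infima of sets of real numbers taken in $[-\infty,\infty]$, $$\alpha_1'=\sup\Big\{c>0:\ \sum_{i=1}^K\sup_{x\in\overline\Omega}\big(b^i(x)y^{n_i}\big)<0\ \ \forall y\in(0,c)\Big\},\qquad \alpha_1=\min\{\alpha_1',\inf_{\partial\Omega}\rho\},$$ $$\alpha_2'=\sup\Big\{c\in\mathbb{R}:\ \sum_{i=1}^K\sup_{x\in\overline\Omega}\big(b^i(x)y^{n_i}\big)<0\ \ \forall y\in(-\infty,c)\Big\},\qquad \alpha_2=\min\{\alpha_2',\inf_{\partial\Omega}\rho\},$$ $$\beta'=\inf\Big\{c\in\mathbb{R}:\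 \sum_{i=1}^K\inf_{x\in\overline\Omega}\big(b^i(x)y^{n_i}\big)>0\ \ \forall y\in(c,\infty)\Big\},\qquad \beta=\max\{\beta',\sup_{\partial\Omega}\rho\}.$$ In case 1, $0<\alpha_1$, $\beta<\infty$, and every weak solution $u$ of $(*)$ with $u>0$ a.e. in $\Omega$ satisfies $\alpha_1\le u\le\beta$ a.e. in $\Omega$. In case 2, $-\infty<\alpha_2$, $\beta<\infty$, and every weak solution $u$ of $(*)$ satisfies $\alpha_2\le u\le\beta$ a.e. in $\Omega$. -/

import Mathlib

open MeasureTheory Set Filter Topology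
open scoped ENNReal ContDiff

namespace SemilinearDirichlet

/-- `ℝ^N` with its Euclidean norm and Lebesgue measure. -/
abbrev Euc (N : ℕ) : Type := EuclideanSpace ℝ (Fin N)

/-- The classical partial derivative `D_i φ`. -/
noncomputable def partialDeriv {N : ℕ} (i : Fin N) (φ : Euc N → ℝ) (x : Euc N) : ℝ :=
  fderiv ℝ φ x (EuclideanSpace.single i 1)

/-- `φ ∈ C_c^∞(Ω)`. -/
structure IsTestFunction {N : ℕ} (Ω : Set (Euc N)) (φ : Euc N → ℝ) : Prop where
  smooth : ContDiff ℝ ∞ φ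
  compact : HasCompactSupport φ
  support : tsupport φ ⊆ Ω

/-- `u ∈ H¹(Ω)` with weak gradient `Du`: `u` and all `Du i` lie in `L²(Ω)`, and `Du i` is the
`i`-th weak derivative of `u` in `Ω`. -/
structure HasH1Gradient {N : ℕ} (Ω : Set (Euc N)) (u : Euc N → ℝ) (Du : Fin N → Euc N → ℝ) :
    Prop where
  memLp : MemLp u 2 (volume.restrict Ω)
  memLp_grad : ∀ i, MemLp (Du i) 2 (volume.restrict Ω)
  weak : ∀ i, ∀ φ : Euc N → ℝ, IsTestFunction Ω φ →
    ∫ x in Ω, u x * partialDeriv i φ x = - ∫ x in Ω, Du i x * φ x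

/-- `u ∈ H¹(Ω) = W^{1,2}(Ω)`. -/
def MemH1 {N : ℕ} (Ω : Set (Euc N)) (u : Euc N → ℝ) : Prop :=
  ∃ Du : Fin N → Euc N → ℝ, HasH1Gradient Ω u Du

/-- `u ∈ H¹₀(Ω)`, the closure of `C_c^∞(Ω)` in `H¹(Ω)`. -/
def MemH10 {N : ℕ} (Ω : Set (Euc N)) (u : Euc N → ℝ) : Prop :=
  ∃ Du : Fin N → Euc N → ℝ, HasH1Gradient Ω u Du ∧
    ∃ φ : ℕ → Euc N → ℝ, (∀ k, IsTestFunction Ω (φ k)) ∧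
      Tendsto (fun k => eLpNorm (fun x => u x - φ k x) 2 (volume.restrict Ω)) atTop (𝓝 0) ∧
      ∀ i, Tendsto (fun k => eLpNorm (fun x => Du i x - partialDeriv i (φ k) x) 2
        (volume.restrict Ω)) atTop (𝓝 0)

/-- `u = ρ` on `∂Ω` for `u ∈ H¹(Ω)` and continuous boundary data `ρ`: `u = w + u₀` with
`u₀ ∈ H¹₀(Ω)` and `w ∈ H¹(Ω) ∩ C(Ω̄)` equal to `ρ` at every point of `∂Ω`. -/
def HasBoundaryValue {N : ℕ} (Ω : Set (Euc N)) (u ρ : Euc N → ℝ) : Prop :=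
  ∃ w : Euc N → ℝ, MemH1 Ω w ∧ ContinuousOn w (closure Ω) ∧ (∀ x ∈ frontier Ω, w x = ρ x) ∧
    MemH10 Ω (fun x => u x - w x)

/-- `u ∈ H¹(Ω)` is a weak solution of
`-∑_{i,j} D_i (a^{ij} D_j u) + ∑_i b^i u^{n_i} = 0` in `Ω`, `u = ρ` on `∂Ω`.
The nonlinear term has to be locally integrable in `Ω`, so that testing against
`C_c^∞(Ω)` makes sense. -/
structure IsWeakSolution {N K : ℕ} (Ω : Set (Euc N)) (a : Fin N → Fin N → Euc N → ℝ)
    (b : Fin K → Euc N → ℝ) (n : Fin K → ℤ) (ρ u : Euc N → ℝ) : Prop where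
  locallyIntegrable : LocallyIntegrableOn (fun x => ∑ i, b i x * u x ^ n i) Ω volume
  equation : ∃ Du : Fin N → Euc N → ℝ, HasH1Gradient Ω u Du ∧
    ∀ φ : Euc N → ℝ, IsTestFunction Ω φ →
      (∫ x in Ω, ∑ i, ∑ j, a i j x * Du j x * partialDeriv i φ x)
        + ∫ x in Ω, (∑ i, b i x * u x ^ n i) * φ x = 0
  boundary : HasBoundaryValue Ω u ρ

/-- `∑_i sup_{x ∈ Ω̄} (b^i(x) y^{n_i})`. -/
noncomputable def supSum {N K : ℕ} (Ω : Set (Euc N)) (b : Fin K → Euc N → ℝ) (n : Fin K → ℤ)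
    (y : ℝ) : ℝ :=
  ∑ i, ⨆ x : closure Ω, b i x * y ^ n i

/-- `∑_i inf_{x ∈ Ω̄} (b^i(x) y^{n_i})`. -/
noncomputable def infSum {N K : ℕ} (Ω : Set (Euc N)) (b : Fin K → Euc N → ℝ) (n : Fin K → ℤ)
    (y : ℝ) : ℝ :=
  ∑ i, ⨅ x : closure Ω, b i x * y ^ n i

/-- `α₁' = sup {c > 0 : ∑_i sup b^i y^{n_i} < 0 for all y ∈ (0, c)}`, in `[-∞, ∞]`. -/
noncomputable def alphaOne' {N K : ℕ} (Ω : Set (Euc N)) (b : Fin K → Euc N → ℝ)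
    (n : Fin K → ℤ) : EReal :=
  ⨆ c ∈ {c : ℝ | 0 < c ∧ ∀ y ∈ Ioo 0 c, supSum Ω b n y < 0}, (c : EReal)

/-- `α₁ = min {α₁', inf_{∂Ω} ρ}`. -/
noncomputable def alphaOne {N K : ℕ} (Ω : Set (Euc N)) (b : Fin K → Euc N → ℝ)
    (n : Fin K → ℤ) (ρ : Euc N → ℝ) : EReal :=
  min (alphaOne' Ω b n) (⨅ x ∈ frontier Ω, (ρ x : EReal))

/-- `α₂' = sup {c ∈ ℝ : ∑_i sup b^i y^{n_i} < 0 for all y ∈ (-∞, c)}`, in `[-∞, ∞]`. -/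
noncomputable def alphaTwo' {N K : ℕ} (Ω : Set (Euc N)) (b : Fin K → Euc N → ℝ)
    (n : Fin K → ℤ) : EReal :=
  ⨆ c ∈ {c : ℝ | ∀ y ∈ Iio c, supSum Ω b n y < 0}, (c : EReal)

/-- `α₂ = min {α₂', inf_{∂Ω} ρ}`. -/
noncomputable def alphaTwo {N K : ℕ} (Ω : Set (Euc N)) (b : Fin K → Euc N → ℝ)
    (n : Fin K → ℤ) (ρ : Euc N → ℝ) : EReal :=
  min (alphaTwo' Ω b n) (⨅ x ∈ frontier Ω, (ρ x : EReal))

/-- `β' = inf {c ∈ ℝ : ∑_i inf b^i y^{n_i} > 0 for all y ∈ (c, ∞)}`, in `[-∞, ∞]`. -/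
noncomputable def betaBound' {N K : ℕ} (Ω : Set (Euc N)) (b : Fin K → Euc N → ℝ)
    (n : Fin K → ℤ) : EReal :=
  ⨅ c ∈ {c : ℝ | ∀ y ∈ Ioi c, 0 < infSum Ω b n y}, (c : EReal)

/-- `β = max {β', sup_{∂Ω} ρ}`. -/
noncomputable def betaBound {N K : ℕ} (Ω : Set (Euc N)) (b : Fin K → Euc N → ℝ)
    (n : Fin K → ℤ) (ρ : Euc N → ℝ) : EReal :=
  max (betaBound' Ω b n) (⨆ x ∈ frontier Ω, (ρ x : EReal))

end SemilinearDirichlet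

/-! The argument is a weak maximum principle by truncation. Let `M` be a real number above `β`, and
write `f = ∑ b i * u ^ n i`. Then `f ≥ 0` wherever `u > M`, and `ρ < M` on the boundary. Let `G` be
a smooth bounded nondecreasing ramp vanishing exactly on `(-∞, M]`. Testing formally with `G(u)²`
gives `∫ 2 G(u) G'(u) a Du · Du ≤ 0`, so by ellipticity the gradient of `G(u)²` vanishes. Since
`G(u)²` has zero boundary values, `G(u) = 0`, that is, `u ≤ M`. Letting `M` decrease to `β` through
the rationals gives the upper bound; the lower bounds come from the same principle applied to `-u`.
That the bounds are finite or positive holds because the term with the extreme exponent dominates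
for extreme `y`.

`G(u)²` is not itself admissible: `f` is only locally integrable, and the boundary condition holds
only through `H¹₀`. One factor is therefore replaced by `G(z k)`, where `z k = w + φ k → u` and `φ
k` are test functions. As `w < M` on the boundary, `G(z k)` vanishes off a compact subset of `Ω`, so
`G(u) G(z k)` is a bounded limit of test functions (`exists_test_approx`) and may be inserted in the
equation (`weak_equation_gradProd`). The remaining factor `G(u)` already gives the `f`-term its sign
for each `k`, so only gradient terms have to converge. Poincaré's inequality is replaced by the
identity `∫ v = -∫ x i * ∂ᵢv`, which passes to the same limits. All this is assembled in
`ae_le_of_weak_solution`. -/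

namespace SemilinearDirichlet

/-! ### Mollification in `L²`. -/

/-- The mollification of `f` by a normalized bump function. -/
noncomputable def mollify {N : ℕ} (φ : ContDiffBump (0 : Euc N)) (f : Euc N → ℝ) : Euc N → ℝ :=
  convolution (φ.normed volume) f (ContinuousLinearMap.lsmul ℝ ℝ) volume

theorem mollify_apply {N : ℕ} (φ : ContDiffBump (0 : Euc N)) (f : Euc N → ℝ) (x : Euc N) :
    mollify φ f x = ∫ t, φ.normed volume t * f (x - t) := by
  simp [mollify, convolution_def]

theorem contDiff_mollify {N : ℕ} (φ : ContDiffBump (0 : Euc N)) {f : Euc N → ℝ}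
    (hf : LocallyIntegrable f volume) : ContDiff ℝ ∞ (mollify φ f) :=
  φ.hasCompactSupport_normed.contDiff_convolution_left _ φ.contDiff_normed hf

theorem mollify_sub {N : ℕ} (φ : ContDiffBump (0 : Euc N)) {f g : Euc N → ℝ}
    (hf : LocallyIntegrable f volume) (hg : LocallyIntegrable g volume) :
    mollify φ (f - g) = mollify φ f - mollify φ g := by
  have h1 := φ.hasCompactSupport_normed (μ := volume).convolutionExists_left
    (ContinuousLinearMap.lsmul ℝ ℝ) φ.continuous_normed hf
  have h2 := φ.hasCompactSupport_normed (μ := volume).convolutionExists_left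
    (ContinuousLinearMap.lsmul ℝ ℝ) φ.continuous_normed hg
  have h3 := φ.hasCompactSupport_normed (μ := volume).convolutionExists_left
    (ContinuousLinearMap.lsmul ℝ ℝ) φ.continuous_normed (hf.sub hg)
  have := h3.distrib_add h2
  rw [sub_add_cancel] at this
  exact eq_sub_of_add_eq this.symm

theorem lintegral_enorm_normed {N : ℕ} (φ : ContDiffBump (0 : Euc N)) :
    ∫⁻ t, ‖φ.normed volume t‖ₑ = 1 := by
  have h := ofReal_integral_norm_eq_lintegral_enorm (φ.integrable_normed (μ := volume))
  rw [← h]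
  simp_rw [Real.norm_of_nonneg (φ.nonneg_normed _), φ.integral_normed, ENNReal.ofReal_one]

/-- Jensen's inequality for the square, obtained as the inclusion of `L²` in `L¹` for the
probability measure whose density is the kernel. -/
theorem enorm_mollify_sq_le {N : ℕ} (φ : ContDiffBump (0 : Euc N)) {f : Euc N → ℝ}
    (hf : AEStronglyMeasurable f volume) (x : Euc N) :
    ‖mollify φ f x‖ₑ ^ (2 : ℝ) ≤ ∫⁻ t, ‖φ.normed volume t‖ₑ * ‖f (x - t)‖ₑ ^ (2 : ℝ) := by
  have hm : AEMeasurable (fun t => ‖φ.normed (volume : Measure (Euc N)) t‖ₑ) volume :=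
    φ.continuous_normed.measurable.enorm.aemeasurable
  have hfx : AEStronglyMeasurable (fun t => f (x - t)) volume :=
    hf.comp_quasiMeasurePreserving (quasiMeasurePreserving_sub_left volume x)
  set ν : Measure (Euc N) := volume.withDensity fun t => ‖φ.normed volume t‖ₑ with hν
  have : IsProbabilityMeasure ν :=
    ⟨by rw [hν, withDensity_apply _ MeasurableSet.univ, setLIntegral_univ,
      lintegral_enorm_normed]⟩
  have hfν : AEStronglyMeasurable (fun t => f (x - t)) ν :=
    hfx.mono_ac (withDensity_absolutelyContinuous _ _)
  have h1 := eLpNorm_le_eLpNorm_of_exponent_le (p := 1) (q := 2) (by norm_num) hfν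
  rw [eLpNorm_one_eq_lintegral_enorm,
    eLpNorm_eq_lintegral_rpow_enorm_toReal (by norm_num) (by norm_num)] at h1
  rw [hν, lintegral_withDensity_eq_lintegral_mul₀ hm hfx.enorm,
    lintegral_withDensity_eq_lintegral_mul₀ hm (hfx.enorm.pow_const _)] at h1
  have h2 : ‖mollify φ f x‖ₑ ≤ ∫⁻ t, ‖φ.normed volume t‖ₑ * ‖f (x - t)‖ₑ := by
    rw [mollify_apply]
    refine (enorm_integral_le_lintegral_enorm _).trans_eq ?_
    simp_rw [enorm_mul]
  refine (ENNReal.rpow_le_rpow (h2.trans h1) (by norm_num)).trans_eq ?_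
  rw [← ENNReal.rpow_mul]
  norm_num

/-- Integrate the pointwise Jensen bound, exchange the integrals and use translation invariance. The
bound does not depend on the kernel, which allows the density argument below. -/
theorem eLpNorm_mollify_le {N : ℕ} (φ : ContDiffBump (0 : Euc N)) {f : Euc N → ℝ}
    (hf : AEStronglyMeasurable f volume) :
    eLpNorm (mollify φ f) 2 volume ≤ eLpNorm f 2 volume := by
  rw [eLpNorm_eq_lintegral_rpow_enorm_toReal (by norm_num) (by norm_num),
    eLpNorm_eq_lintegral_rpow_enorm_toReal (by norm_num) (by norm_num)]
  refine ENNReal.rpow_le_rpow ?_ (by norm_num)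
  simp only [ENNReal.toReal_ofNat]
  refine (lintegral_mono fun x => enorm_mollify_sq_le φ hf x).trans ?_
  have hmeas : AEMeasurable (Function.uncurry fun x t : Euc N =>
      ‖φ.normed (volume : Measure (Euc N)) t‖ₑ * ‖f (x - t)‖ₑ ^ (2 : ℝ))
      (volume.prod volume) := by
    refine AEMeasurable.mul ?_ (AEMeasurable.pow_const ?_ _)
    · exact (φ.continuous_normed.measurable.enorm.comp measurable_snd).aemeasurable
    · exact (hf.comp_quasiMeasurePreserving
        (quasiMeasurePreserving_sub_of_right_invariant volume volume)).enorm
  rw [lintegral_lintegral_swap hmeas]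
  have : ∀ t : Euc N, ∫⁻ x, ‖φ.normed (volume : Measure (Euc N)) t‖ₑ * ‖f (x - t)‖ₑ ^ (2 : ℝ)
      = ‖φ.normed (volume : Measure (Euc N)) t‖ₑ * ∫⁻ x, ‖f x‖ₑ ^ (2 : ℝ) := by
    intro t
    rw [lintegral_const_mul' _ _ enorm_ne_top,
      lintegral_sub_right_eq_self (fun x => ‖f x‖ₑ ^ (2 : ℝ)) t]
  simp_rw [this]
  rw [lintegral_mul_const _ φ.continuous_normed.measurable.enorm, lintegral_enorm_normed, one_mul]

/-- Approximate `f` in `L²` by a continuous compactly supported `g`. Mollification is uniformly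
close to the identity on `g` and contracts the error `f - g`; finiteness of `volume S` turns the
uniform bound into an `L²` bound. -/
theorem tendsto_eLpNorm_mollify_sub {N : ℕ} {φ : ℕ → ContDiffBump (0 : Euc N)}
    (hφ : Tendsto (fun m => (φ m).rOut) atTop (𝓝 0)) {f : Euc N → ℝ} (hf : MemLp f 2 volume)
    (S : Set (Euc N)) (hS : volume S < ⊤) :
    Tendsto (fun m => eLpNorm (f - mollify (φ m) f) 2 (volume.restrict S)) atTop (𝓝 0) := by
  have hfl : LocallyIntegrable f volume := hf.locallyIntegrable (by norm_num)
  rw [ENNReal.tendsto_nhds_zero]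
  intro ε hε
  obtain ⟨δ, hδ, hδε⟩ : ∃ δ : ℝ≥0∞, 0 < δ ∧ δ + δ + δ ≤ ε :=
    ⟨ε / 3, ENNReal.div_pos hε.ne' (by norm_num), by rw [ENNReal.add_thirds]⟩
  obtain ⟨g, hgc, hfg, hg, hgL⟩ :=
    hf.exists_hasCompactSupport_eLpNorm_sub_le (by norm_num) hδ.ne'
  have hgl : LocallyIntegrable g volume := hg.locallyIntegrable
  obtain ⟨η, hη, hηδ⟩ : ∃ η : ℝ, 0 < η ∧
      volume S ^ (2 : ℝ)⁻¹ * ENNReal.ofReal η ≤ δ := by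
    have hV : volume S ^ (2 : ℝ)⁻¹ ≠ ⊤ := ENNReal.rpow_ne_top_of_nonneg (by norm_num) hS.ne
    have : Tendsto (fun η : ℝ => volume S ^ (2 : ℝ)⁻¹ * ENNReal.ofReal η) (𝓝[>] 0)
        (𝓝 (volume S ^ (2 : ℝ)⁻¹ * ENNReal.ofReal 0)) :=
      (ENNReal.Tendsto.const_mul (ENNReal.continuous_ofReal.tendsto 0) (Or.inr hV)).mono_left
        nhdsWithin_le_nhds
    rw [ENNReal.ofReal_zero, mul_zero] at this
    obtain ⟨η, h1, h2⟩ := ((this.eventually (Iic_mem_nhds hδ)).and self_mem_nhdsWithin).exists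
    exact ⟨η, h2, h1⟩
  obtain ⟨r, hr, hgr⟩ := Metric.uniformContinuous_iff.1
    (hgc.uniformContinuous_of_continuous hg) η hη
  filter_upwards [hφ.eventually (Iio_mem_nhds hr)] with m hm
  have hdec : f - mollify (φ m) f
      = (f - g) + (g - mollify (φ m) g) + (-mollify (φ m) (f - g)) := by
    rw [mollify_sub _ hfl hgl]; abel
  have hmg : AEStronglyMeasurable (mollify (φ m) g) (volume.restrict S) :=
    (contDiff_mollify _ hgl).continuous.aestronglyMeasurable
  have hmfg : AEStronglyMeasurable (mollify (φ m) (f - g)) (volume.restrict S) :=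
    (contDiff_mollify _ (hfl.sub hgl)).continuous.aestronglyMeasurable
  have h1 : AEStronglyMeasurable (f - g) (volume.restrict S) := (hf.1.sub hgL.1).restrict
  have h2 : AEStronglyMeasurable (g - mollify (φ m) g) (volume.restrict S) :=
    hgL.1.restrict.sub hmg
  rw [hdec]
  refine (eLpNorm_add_le (h1.add h2) hmfg.neg (by norm_num)).trans ?_
  refine (add_le_add (eLpNorm_add_le h1 h2 (by norm_num)) le_rfl).trans (le_trans ?_ hδε)
  refine add_le_add (add_le_add ?_ ?_) ?_
  · exact (eLpNorm_mono_measure _ Measure.restrict_le_self).trans hfg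
  · refine (eLpNorm_le_of_ae_bound (C := η) (Eventually.of_forall fun x => ?_)).trans ?_
    · rw [Pi.sub_apply, ← dist_eq_norm, dist_comm]
      refine ContDiffBump.dist_normed_convolution_le hg.aestronglyMeasurable fun y hy => ?_
      exact (hgr (lt_trans hy hm)).le
    · simpa using hηδ
  · rw [eLpNorm_neg]
    exact (eLpNorm_mono_measure _ Measure.restrict_le_self).trans
      ((eLpNorm_mollify_le _ (hf.1.sub hgL.1)).trans hfg)

/-! ### Smooth approximation of Sobolev functions. -/

/-- The derivative falls on the kernel, and the reflected kernel centred at `x` is a test function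
because its closed ball lies in `Ω`. The definition of weak derivative then moves it onto `u`. -/
theorem partialDeriv_mollify {N : ℕ} {Ω : Set (Euc N)} (hΩ : MeasurableSet Ω) {u : Euc N → ℝ}
    {Du : Fin N → Euc N → ℝ} (h : HasH1Gradient Ω u Du) (φ : ContDiffBump (0 : Euc N))
    {x : Euc N} (hx : Metric.closedBall x φ.rOut ⊆ Ω) (i : Fin N) :
    partialDeriv i (mollify φ (Ω.indicator u)) x = mollify φ (Ω.indicator (Du i)) x := by
  have hul : LocallyIntegrable (Ω.indicator u) volume :=
    ((memLp_indicator_iff_restrict hΩ).2 h.memLp).locallyIntegrable (by norm_num)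
  have hd := φ.hasCompactSupport_normed (μ := volume).hasFDerivAt_convolution_left
    (ContinuousLinearMap.lsmul ℝ ℝ) φ.contDiff_normed hul x
  have hcomp : HasCompactSupport (fderiv ℝ (φ.normed (volume : Measure (Euc N)))) :=
    φ.hasCompactSupport_normed.fderiv ℝ
  have hcont : Continuous (fderiv ℝ (φ.normed (volume : Measure (Euc N)))) :=
    φ.contDiff_normed.continuous_fderiv (n := 1) one_ne_zero
  have hint := (hcomp.convolutionExists_left
    ((ContinuousLinearMap.lsmul ℝ ℝ).precompL (Euc N)) hcont hul x).integrable
  have e1 : partialDeriv i (mollify φ (Ω.indicator u)) x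
      = ∫ t, fderiv ℝ (φ.normed volume) t (EuclideanSpace.single i 1)
          * Ω.indicator u (x - t) := by
    rw [partialDeriv, mollify, hd.fderiv, convolution_def,
      ContinuousLinearMap.integral_apply hint]
    simp [ContinuousLinearMap.precompL_apply]
  set ψ : Euc N → ℝ := fun y => φ.normed volume (x - y) with hψ
  have hψt : IsTestFunction Ω ψ := by
    have hts : tsupport ψ ⊆ Metric.closedBall x φ.rOut := by
      refine closure_minimal (fun y hy => ?_) Metric.isClosed_closedBall
      have : x - y ∈ Function.support (φ.normed volume) := hy
      rw [φ.support_normed_eq, Metric.mem_ball, dist_zero_right] at this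
      rw [Metric.mem_closedBall, dist_comm, dist_eq_norm]
      exact this.le
    refine ⟨φ.contDiff_normed.comp (contDiff_const.sub contDiff_id), ?_, hts.trans hx⟩
    exact HasCompactSupport.of_support_subset_isCompact (isCompact_closedBall x φ.rOut)
      ((subset_tsupport _).trans hts)
  have hψd : ∀ y, partialDeriv i ψ y
      = - fderiv ℝ (φ.normed volume) (x - y) (EuclideanSpace.single i 1) := by
    intro y
    have h1 : HasFDerivAt (φ.normed volume) (fderiv ℝ (φ.normed volume) (x - y)) (x - y) :=
      ((φ.contDiff_normed (n := 1)).differentiable (by norm_num) _).hasFDerivAt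
    have h2 : HasFDerivAt (fun y => x - y) (-ContinuousLinearMap.id ℝ (Euc N)) y :=
      (hasFDerivAt_id y).const_sub x
    have h3 : HasFDerivAt ψ _ y := h1.comp y h2
    rw [partialDeriv, h3.fderiv]
    simp
  have key := h.weak i ψ hψt
  rw [e1, mollify_apply, ← integral_sub_left_eq_self _ volume x,
    ← integral_sub_left_eq_self (fun t => φ.normed volume t * Ω.indicator (Du i) (x - t))
      volume x]
  simp only [sub_sub_cancel]
  simp_rw [hψd, mul_neg, integral_neg, neg_inj] at key
  rw [← integral_indicator hΩ, ← integral_indicator hΩ] at key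
  refine Eq.trans ?_ (key.trans ?_) <;> refine integral_congr_ae (ae_of_all _ fun y => ?_)
  · by_cases hy : y ∈ Ω <;> simp [hy, mul_comm]
  · by_cases hy : y ∈ Ω <;> simp [hy, mul_comm, hψ]

/-- Smooth functions approximate `u ∈ H¹(Ω)` almost everywhere, with gradients converging in `L²`
on compact subsets of `Ω`. -/
theorem HasH1Gradient.exists_smooth_approx {N : ℕ} {Ω : Set (Euc N)} (hΩ : IsOpen Ω)
    {u : Euc N → ℝ} {Du : Fin N → Euc N → ℝ} (h : HasH1Gradient Ω u Du) :
    ∃ U : ℕ → Euc N → ℝ, (∀ m, ContDiff ℝ ∞ (U m)) ∧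
      (∀ᵐ x ∂volume.restrict Ω, Tendsto (fun m => U m x) atTop (𝓝 (u x))) ∧
      ∀ S : Set (Euc N), IsCompact S → S ⊆ Ω → ∀ i, Tendsto (fun m =>
        eLpNorm (Du i - partialDeriv i (U m)) 2 (volume.restrict S)) atTop (𝓝 0) := by
  have hΩm := hΩ.measurableSet
  -- The ratio of outer to inner radius stays equal to 2, as almost everywhere convergence of the
  -- mollifications needs a bounded ratio.
  let φ : ℕ → ContDiffBump (0 : Euc N) := fun m =>
    ⟨1 / ((m : ℝ) + 1), 2 * (1 / ((m : ℝ) + 1)), by positivity, by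
      have : 0 < 1 / ((m : ℝ) + 1) := by positivity
      linarith⟩
  have hφ : Tendsto (fun m => (φ m).rOut) atTop (𝓝 0) := by
    simpa [φ] using (tendsto_one_div_add_atTop_nhds_zero_nat (𝕜 := ℝ)).const_mul 2
  have huL := (memLp_indicator_iff_restrict hΩm).2 h.memLp
  have hul : LocallyIntegrable (Ω.indicator u) volume := huL.locallyIntegrable (by norm_num)
  refine ⟨fun m => mollify (φ m) (Ω.indicator u), fun m => contDiff_mollify _ hul, ?_, ?_⟩
  · have := ContDiffBump.ae_convolution_tendsto_right_of_locallyIntegrable (K := 2) hφ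
      (Eventually.of_forall fun m => le_rfl) hul
    filter_upwards [ae_restrict_of_ae this, ae_restrict_mem hΩm] with x hx hxΩ
    rw [indicator_of_mem hxΩ] at hx
    exact hx
  · intro S hS hSΩ i
    have hD := (memLp_indicator_iff_restrict hΩm).2 (h.memLp_grad i)
    obtain ⟨δ, hδ, hδΩ⟩ := hS.exists_cthickening_subset_open hΩ hSΩ
    refine (tendsto_eLpNorm_mollify_sub hφ hD S hS.measure_lt_top).congr' ?_
    filter_upwards [hφ.eventually (Iio_mem_nhds hδ)] with m hm
    refine eLpNorm_congr_ae ?_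
    filter_upwards [ae_restrict_mem hS.measurableSet] with x hx
    have hball : Metric.closedBall x (φ m).rOut ⊆ Ω :=
      ((Metric.closedBall_subset_closedBall (le_of_lt hm)).trans
        (Metric.closedBall_subset_cthickening hx δ)).trans hδΩ
    simp [partialDeriv_mollify hΩm h (φ m) hball i, hSΩ hx]

/-! ### Limits of integrals of products. -/

theorem memLp_mul_of_bound {α : Type*} {m : MeasurableSpace α} {μ : Measure α} {h p : α → ℝ}
    (hh : MemLp h 2 μ) (hp : AEStronglyMeasurable p μ) {C : ℝ} (hC : ∀ᵐ x ∂μ, |p x| ≤ C) :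
    MemLp (fun x => h x * p x) 2 μ := by
  refine hh.of_le_mul (c := C) (hh.1.mul hp) ?_
  filter_upwards [hC] with x hx
  rw [norm_mul, mul_comm]
  exact mul_le_mul_of_nonneg_right hx (norm_nonneg _)

/-- With `q'` frozen, dominated convergence handles the bounded factors `p k`; the error from `q' -
q k` is controlled by Cauchy–Schwarz. -/
theorem tendsto_integral_mul_mul {α : Type*} {m : MeasurableSpace α} {μ : Measure α}
    {h : α → ℝ} (hh : MemLp h 2 μ) {p : ℕ → α → ℝ} {p' : α → ℝ}
    (hp : ∀ k, AEStronglyMeasurable (p k) μ) {C : ℝ} (hC : ∀ k, ∀ᵐ x ∂μ, |p k x| ≤ C)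
    (hpt : ∀ᵐ x ∂μ, Tendsto (fun k => p k x) atTop (𝓝 (p' x)))
    {q : ℕ → α → ℝ} {q' : α → ℝ} (hq : ∀ k, MemLp (q k) 2 μ) (hq' : MemLp q' 2 μ)
    (hqt : Tendsto (fun k => eLpNorm (q' - q k) 2 μ) atTop (𝓝 0)) :
    Tendsto (fun k => ∫ x, h x * p k x * q k x ∂μ) atTop (𝓝 (∫ x, h x * p' x * q' x ∂μ)) := by
  have hhp : ∀ k, MemLp (fun x => h x * p k x) 2 μ := fun k => memLp_mul_of_bound hh (hp k) (hC k)
  have h1 : Tendsto (fun k => ∫ x, h x * p k x * q' x ∂μ) atTop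
      (𝓝 (∫ x, h x * p' x * q' x ∂μ)) := by
    refine tendsto_integral_of_dominated_convergence (fun x => C * ‖h x * q' x‖)
      (fun k => ((hhp k).1.mul hq'.1)) ((hh.integrable_mul hq').norm.const_mul C) ?_ ?_
    · intro k
      filter_upwards [hC k] with x hx
      rw [mul_right_comm, norm_mul, mul_comm]
      exact mul_le_mul_of_nonneg_right hx (norm_nonneg _)
    · filter_upwards [hpt] with x hx
      exact (hx.const_mul _).mul_const _
  have h2 : Tendsto (fun k => ∫ x, h x * p k x * (q' - q k) x ∂μ) atTop (𝓝 0) := by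
    rw [tendsto_zero_iff_enorm_tendsto_zero]
    have hb : Tendsto (fun k => ENNReal.ofReal C * eLpNorm h 2 μ * eLpNorm (q' - q k) 2 μ) atTop
        (𝓝 0) := by
      have := ENNReal.Tendsto.const_mul (a := ENNReal.ofReal C * eLpNorm h 2 μ) hqt
        (Or.inr (ENNReal.mul_ne_top ENNReal.ofReal_ne_top hh.2.ne))
      simpa using this
    refine tendsto_of_tendsto_of_tendsto_of_le_of_le tendsto_const_nhds hb
      (fun _ => zero_le) fun k => ?_
    refine (enorm_integral_le_lintegral_enorm _).trans ?_
    rw [← eLpNorm_one_eq_lintegral_enorm]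
    refine (eLpNorm_smul_le_mul_eLpNorm (p := 2) (q := 2) (r := 1) (hq'.1.sub (hq k).1)
      (hhp k).1).trans (mul_le_mul_left ?_ _)
    refine eLpNorm_le_mul_eLpNorm_of_ae_le_mul ?_ 2
    filter_upwards [hC k] with x hx
    rw [norm_mul, mul_comm]
    exact mul_le_mul_of_nonneg_right hx (norm_nonneg _)
  have h3 := h1.sub h2
  rw [sub_zero] at h3
  refine h3.congr fun k => ?_
  refine (integral_sub ((hhp k).integrable_mul hq')
    ((hhp k).integrable_mul (hq'.sub (hq k)))).symm.trans ?_
  refine integral_congr_ae (ae_of_all _ fun x => ?_)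
  simp only [Pi.sub_apply, Pi.mul_apply]
  ring

/-! ### Calculus of smooth limits, and cutoffs. -/

/-- `u` is an almost everywhere limit of smooth functions whose gradients converge to `Du` in `L²`
on compact subsets of `Ω`. -/
structure IsSmoothLimit {N : ℕ} (Ω : Set (Euc N)) (u : Euc N → ℝ) (Du : Fin N → Euc N → ℝ) :
    Prop where
  memLp_grad : ∀ i, MemLp (Du i) 2 (volume.restrict Ω)
  exists_approx : ∃ U : ℕ → Euc N → ℝ, (∀ m, ContDiff ℝ ∞ (U m)) ∧
    (∀ᵐ x ∂volume.restrict Ω, Tendsto (fun m => U m x) atTop (𝓝 (u x))) ∧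
    ∀ S : Set (Euc N), IsCompact S → S ⊆ Ω → ∀ i, Tendsto (fun m =>
      eLpNorm (Du i - partialDeriv i (U m)) 2 (volume.restrict S)) atTop (𝓝 0)

theorem HasH1Gradient.isSmoothLimit {N : ℕ} {Ω : Set (Euc N)} (hΩ : IsOpen Ω)
    {u : Euc N → ℝ} {Du : Fin N → Euc N → ℝ} (h : HasH1Gradient Ω u Du) :
    IsSmoothLimit Ω u Du :=
  ⟨h.memLp_grad, h.exists_smooth_approx hΩ⟩

theorem partialDeriv_add {N : ℕ} (i : Fin N) {f g : Euc N → ℝ} {x : Euc N}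
    (hf : DifferentiableAt ℝ f x) (hg : DifferentiableAt ℝ g x) :
    partialDeriv i (f + g) x = partialDeriv i f x + partialDeriv i g x := by
  simp [partialDeriv, fderiv_add hf hg]

theorem partialDeriv_mul {N : ℕ} (i : Fin N) {f g : Euc N → ℝ} {x : Euc N}
    (hf : DifferentiableAt ℝ f x) (hg : DifferentiableAt ℝ g x) :
    partialDeriv i (f * g) x = f x * partialDeriv i g x + g x * partialDeriv i f x := by
  simp [partialDeriv, (hf.hasFDerivAt.mul hg.hasFDerivAt).fderiv]

theorem partialDeriv_comp {N : ℕ} (i : Fin N) {G : ℝ → ℝ} {f : Euc N → ℝ} {x : Euc N}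
    (hG : DifferentiableAt ℝ G (f x)) (hf : DifferentiableAt ℝ f x) :
    partialDeriv i (G ∘ f) x = deriv G (f x) * partialDeriv i f x := by
  simp [partialDeriv, (hG.hasDerivAt.comp_hasFDerivAt x hf.hasFDerivAt).fderiv]

theorem continuous_partialDeriv {N : ℕ} (i : Fin N) {f : Euc N → ℝ} (hf : ContDiff ℝ ∞ f) :
    Continuous (partialDeriv i f) :=
  (hf.continuous_fderiv (by simp)).clm_apply continuous_const

theorem partialDeriv_eq_zero_of_notMem_tsupport {N : ℕ} (i : Fin N) {f : Euc N → ℝ} {x : Euc N}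
    (hx : x ∉ tsupport f) : partialDeriv i f x = 0 := by
  have : fderiv ℝ f x = 0 := by
    by_contra h
    exact hx (support_fderiv_subset ℝ h)
  simp [partialDeriv, this]

theorem _root_.Continuous.memLp_restrict_of_isCompact {N : ℕ} {f : Euc N → ℝ} (hf : Continuous f)
    {S : Set (Euc N)} (hS : IsCompact S) : MemLp f 2 (volume.restrict S) := by
  have : IsFiniteMeasure (volume.restrict S) := ⟨by simpa using hS.measure_lt_top⟩
  obtain ⟨C, hC⟩ := hS.exists_bound_of_continuousOn hf.continuousOn
  exact MemLp.of_bound hf.aestronglyMeasurable C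
    ((ae_restrict_iff' hS.measurableSet).2 (ae_of_all _ hC))

theorem IsTestFunction.memLp_partialDeriv {N : ℕ} {Ω : Set (Euc N)} {φ : Euc N → ℝ}
    (hφ : IsTestFunction Ω φ) (i : Fin N) : MemLp (partialDeriv i φ) 2 volume := by
  refine (continuous_partialDeriv i hφ.smooth).memLp_of_hasCompactSupport ?_
  exact HasCompactSupport.of_support_subset_isCompact hφ.compact fun x hx => by
    by_contra h
    exact hx (partialDeriv_eq_zero_of_notMem_tsupport i h)

/-- Applied to the functions `w + φ k` that approximate `u` and agree with `w` near the boundary. -/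
theorem IsSmoothLimit.add_test {N : ℕ} {Ω : Set (Euc N)} {w φ : Euc N → ℝ}
    {Dw : Fin N → Euc N → ℝ} (hw : IsSmoothLimit Ω w Dw) (hφ : IsTestFunction Ω φ) :
    IsSmoothLimit Ω (w + φ) (fun i => Dw i + partialDeriv i φ) := by
  obtain ⟨W, hW, hWt, hWg⟩ := hw.exists_approx
  refine ⟨fun i => (hw.memLp_grad i).add ((hφ.memLp_partialDeriv i).restrict Ω), fun m => W m + φ,
    fun m => (hW m).add hφ.smooth, ?_, fun S hS hSΩ i => ?_⟩
  · filter_upwards [hWt] with x hx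
    exact hx.add_const _
  · refine (hWg S hS hSΩ i).congr fun m => ?_
    congr 1
    ext x
    simp only [Pi.sub_apply, Pi.add_apply]
    rw [partialDeriv_add i ((hW m).differentiable (by simp) x)
      (hφ.smooth.differentiable (by simp) x)]
    ring

theorem exists_test_eq_one {N : ℕ} {Ω S : Set (Euc N)} (hΩ : IsOpen Ω) (hS : IsCompact S)
    (hSΩ : S ⊆ Ω) : ∃ χ : Euc N → ℝ, IsTestFunction Ω χ ∧ (∀ x, |χ x| ≤ 1) ∧
      ∀ x ∈ S, χ =ᶠ[𝓝 x] fun _ => 1 := by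
  obtain ⟨L, hL, hSL, hLΩ⟩ := exists_compact_between hS hΩ hSΩ
  obtain ⟨f, hf1, hf0, hf⟩ := exists_contMDiffMap_one_nhds_of_subset_interior
    (n := ⊤) (modelWithCornersSelf ℝ (Euc N)) hS.isClosed hSL
  have hts : tsupport f ⊆ L := closure_minimal (fun x hx => by
    by_contra h
    exact hx (hf0 x h)) hL.isClosed
  refine ⟨f, ⟨contMDiff_iff_contDiff.1 f.contMDiff, ?_, hts.trans hLΩ⟩, fun x => ?_, ?_⟩
  · exact HasCompactSupport.of_support_subset_isCompact hL ((subset_tsupport _).trans hts)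
  · rw [abs_of_nonneg (hf x).1]
    exact (hf x).2
  · intro x hx
    exact hf1.filter_mono (nhds_le_nhdsSet hx)

theorem integral_add_add {α : Type*} {m : MeasurableSpace α} {μ : Measure α} {f g h : α → ℝ}
    (hf : Integrable f μ) (hg : Integrable g μ) (hh : Integrable h μ) :
    ∫ x, (f x + g x + h x) ∂μ = ∫ x, f x ∂μ + ∫ x, g x ∂μ + ∫ x, h x ∂μ := by
  rw [← integral_add hf hg]
  exact integral_add (hf.add hg) hh

/-! ### The truncated products `G(u) G(z)` as test functions. -/

/-- The gradient of `G(u) G(z)`, by the product and chain rules. -/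
noncomputable def gradProd {N : ℕ} (G : ℝ → ℝ) (u z : Euc N → ℝ) (Du Dz : Fin N → Euc N → ℝ)
    (i : Fin N) (x : Euc N) : ℝ :=
  G (u x) * deriv G (z x) * Dz i x + deriv G (u x) * G (z x) * Du i x

theorem partialDeriv_test_mul {N : ℕ} {χ U Z : Euc N → ℝ} {G : ℝ → ℝ} (hχ : ContDiff ℝ ∞ χ)
    (hU : ContDiff ℝ ∞ U) (hZ : ContDiff ℝ ∞ Z) (hG : ContDiff ℝ ∞ G) (i : Fin N) (x : Euc N) :
    partialDeriv i (χ * ((G ∘ U) * (G ∘ Z))) x =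
      G (U x) * G (Z x) * partialDeriv i χ x + (χ x * G (U x) * deriv G (Z x)) * partialDeriv i Z x
        + (χ x * deriv G (U x) * G (Z x)) * partialDeriv i U x := by
  have hGd : Differentiable ℝ G := hG.differentiable (by simp)
  have hUd := hU.differentiable (by simp) x
  have hZd := hZ.differentiable (by simp) x
  have h1 : DifferentiableAt ℝ (G ∘ U) x := (hGd _).comp x hUd
  have h2 : DifferentiableAt ℝ (G ∘ Z) x := (hGd _).comp x hZd
  rw [partialDeriv_mul i (hχ.differentiable (by simp) x) (h1.mul h2), partialDeriv_mul i h1 h2,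
    partialDeriv_comp i (hGd _) hUd, partialDeriv_comp i (hGd _) hZd]
  simp only [Function.comp_apply, Pi.mul_apply]
  ring

/-- If `G(z)` vanishes off a compact subset of `Ω`, then `G(u) G(z)` is a bounded almost everywhere
limit of test functions whose gradients converge weakly in `L²(Ω)`. -/
theorem exists_test_approx {N : ℕ} {Ω : Set (Euc N)} (hΩ : IsOpen Ω) {u z : Euc N → ℝ}
    {Du Dz : Fin N → Euc N → ℝ} (hu : IsSmoothLimit Ω u Du) (hz : IsSmoothLimit Ω z Dz)
    {G : ℝ → ℝ} (hG : ContDiff ℝ ∞ G) (hG1 : ∀ t, |G t| ≤ 1) {C : ℝ}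
    (hGC : ∀ t, |deriv G t| ≤ C) {S : Set (Euc N)} (hS : IsCompact S) (hSΩ : S ⊆ Ω)
    (hzS : ∀ x ∈ Ω \ S, G (z x) = 0 ∧ deriv G (z x) = 0) :
    ∃ v : ℕ → Euc N → ℝ, (∀ m, IsTestFunction Ω (v m)) ∧
      (∀ i, ∀ h : Euc N → ℝ, MemLp h 2 (volume.restrict Ω) →
        Tendsto (fun m => ∫ x in Ω, h x * partialDeriv i (v m) x) atTop
          (𝓝 (∫ x in Ω, h x * gradProd G u z Du Dz i x))) ∧
      ∀ f : Euc N → ℝ, LocallyIntegrableOn f Ω volume →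
        Tendsto (fun m => ∫ x in Ω, f x * v m x) atTop
          (𝓝 (∫ x in Ω, f x * (G (u x) * G (z x)))) := by
  obtain ⟨U, hU, hUt, hUg⟩ := hu.exists_approx
  obtain ⟨Z, hZ, hZt, hZg⟩ := hz.exists_approx
  -- The approximants of `z` need not make `G` vanish off `S`, so a cutoff is needed to give the
  -- products compact support.
  obtain ⟨χ, hχ, hχ1, hχS⟩ := exists_test_eq_one hΩ hS hSΩ
  have hΩm := hΩ.measurableSet
  have hG' : Continuous (deriv G) := hG.continuous_deriv (by simp)
  set T := tsupport χ with hT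
  have hTc : IsCompact T := hχ.compact
  have hTΩ : T ⊆ Ω := hχ.support
  have hac : ∀ {P : Euc N → Prop}, (∀ᵐ x ∂volume.restrict Ω, P x) →
      ∀ᵐ x ∂volume.restrict T, P x := fun h => ae_restrict_of_ae_restrict_of_subset hTΩ h
  have hST : S ⊆ T := fun x hx => subset_tsupport χ (by
    rw [Function.mem_support, (hχS x hx).eq_of_nhds]; exact one_ne_zero)
  set v : ℕ → Euc N → ℝ := fun m => χ * ((G ∘ U m) * (G ∘ Z m)) with hv
  have hvt : ∀ m, tsupport (v m) ⊆ T := fun m => tsupport_mul_subset_left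
  have hvtest : ∀ m, IsTestFunction Ω (v m) := fun m =>
    ⟨hχ.smooth.mul ((hG.comp (hU m)).mul (hG.comp (hZ m))),
      HasCompactSupport.of_support_subset_isCompact hTc ((subset_tsupport _).trans (hvt m)),
      (hvt m).trans hTΩ⟩
  have hUc := fun m => (hU m).continuous
  have hZc := fun m => (hZ m).continuous
  have hGc := hG.continuous
  have hχc := hχ.smooth.continuous
  refine ⟨v, hvtest, fun i h hh => ?_, fun f hf => ?_⟩
  · have hhT : MemLp h 2 (volume.restrict T) :=
      hh.mono_measure (Measure.restrict_mono hTΩ le_rfl)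
    have hχi : MemLp (partialDeriv i χ) 2 (volume.restrict T) := (hχ.memLp_partialDeriv i).restrict T
    have hUi := fun m => (continuous_partialDeriv i (hU m)).memLp_restrict_of_isCompact hTc
    have hZi := fun m => (continuous_partialDeriv i (hZ m)).memLp_restrict_of_isCompact hTc
    have hDu : MemLp (Du i) 2 (volume.restrict T) :=
      (hu.memLp_grad i).mono_measure (Measure.restrict_mono hTΩ le_rfl)
    have hDz : MemLp (Dz i) 2 (volume.restrict T) :=
      (hz.memLp_grad i).mono_measure (Measure.restrict_mono hTΩ le_rfl)
    have hm1 : ∀ m, AEStronglyMeasurable (fun x => G (U m x) * G (Z m x))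
        (volume.restrict T) := fun m => Continuous.aestronglyMeasurable (by fun_prop)
    have hm2 : ∀ m, AEStronglyMeasurable (fun x => χ x * G (U m x) * deriv G (Z m x))
        (volume.restrict T) := fun m => Continuous.aestronglyMeasurable (by fun_prop)
    have hm3 : ∀ m, AEStronglyMeasurable (fun x => χ x * deriv G (U m x) * G (Z m x))
        (volume.restrict T) := fun m => Continuous.aestronglyMeasurable (by fun_prop)
    have hb1 : ∀ m, ∀ᵐ x ∂volume.restrict T, |G (U m x) * G (Z m x)| ≤ 1 :=
      fun m => ae_of_all _ fun x => by
        rw [abs_mul]; exact mul_le_one₀ (hG1 _) (abs_nonneg _) (hG1 _)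
    have hb2 : ∀ m, ∀ᵐ x ∂volume.restrict T, |χ x * G (U m x) * deriv G (Z m x)| ≤ C :=
      fun m => ae_of_all _ fun x => by
        rw [abs_mul, abs_mul]
        exact (mul_le_of_le_one_left (abs_nonneg _)
          (mul_le_one₀ (hχ1 _) (abs_nonneg _) (hG1 _))).trans (hGC _)
    have hb3 : ∀ m, ∀ᵐ x ∂volume.restrict T, |χ x * deriv G (U m x) * G (Z m x)| ≤ C :=
      fun m => ae_of_all _ fun x => by
        rw [mul_right_comm, abs_mul, abs_mul]
        exact (mul_le_of_le_one_left (abs_nonneg _)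
          (mul_le_one₀ (hχ1 _) (abs_nonneg _) (hG1 _))).trans (hGC _)
    have t1 := tendsto_integral_mul_mul (p' := fun x => G (u x) * G (z x))
      (q := fun _ => partialDeriv i χ) hhT hm1 hb1 (by
        filter_upwards [hac hUt, hac hZt] with x hx1 hx2
        exact ((hGc.tendsto _).comp hx1).mul ((hGc.tendsto _).comp hx2))
      (fun _ => hχi) hχi (by simp)
    have t2 := tendsto_integral_mul_mul (p' := fun x => χ x * G (u x) * deriv G (z x))
      hhT hm2 hb2 (by
        filter_upwards [hac hUt, hac hZt] with x hx1 hx2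
        exact (((hGc.tendsto _).comp hx1).const_mul _).mul ((hG'.tendsto _).comp hx2))
      hZi hDz (hZg T hTc hTΩ i)
    have t3 := tendsto_integral_mul_mul (p' := fun x => χ x * deriv G (u x) * G (z x))
      hhT hm3 hb3 (by
        filter_upwards [hac hUt, hac hZt] with x hx1 hx2
        exact (((hG'.tendsto _).comp hx1).const_mul _).mul ((hGc.tendsto _).comp hx2))
      hUi hDu (hUg T hTc hTΩ i)
    have hGu : AEStronglyMeasurable u (volume.restrict T) :=
      aestronglyMeasurable_of_tendsto_ae atTop (fun m => (hUc m).aestronglyMeasurable) (hac hUt)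
    have hGz : AEStronglyMeasurable z (volume.restrict T) :=
      aestronglyMeasurable_of_tendsto_ae atTop (fun m => (hZc m).aestronglyMeasurable) (hac hZt)
    have i1 : ∀ m, Integrable (fun x => h x * (G (U m x) * G (Z m x)) * partialDeriv i χ x)
        (volume.restrict T) := fun m =>
      (memLp_mul_of_bound hhT (hm1 m) (hb1 m)).integrable_mul hχi
    have i2 : ∀ m, Integrable (fun x => h x * (χ x * G (U m x) * deriv G (Z m x))
        * partialDeriv i (Z m) x) (volume.restrict T) := fun m =>
      (memLp_mul_of_bound hhT (hm2 m) (hb2 m)).integrable_mul (hZi m)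
    have i3 : ∀ m, Integrable (fun x => h x * (χ x * deriv G (U m x) * G (Z m x))
        * partialDeriv i (U m) x) (volume.restrict T) := fun m =>
      (memLp_mul_of_bound hhT (hm3 m) (hb3 m)).integrable_mul (hUi m)
    have j1 : Integrable (fun x => h x * (G (u x) * G (z x)) * partialDeriv i χ x)
        (volume.restrict T) :=
      (memLp_mul_of_bound (C := 1) hhT ((hGc.comp_aestronglyMeasurable hGu).mul
        (hGc.comp_aestronglyMeasurable hGz)) (ae_of_all _ fun x => by
        rw [Pi.mul_apply, abs_mul]; exact mul_le_one₀ (hG1 _) (abs_nonneg _) (hG1 _))).integrable_mul hχi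
    have j2 : Integrable (fun x => h x * (χ x * G (u x) * deriv G (z x)) * Dz i x)
        (volume.restrict T) :=
      (memLp_mul_of_bound (C := C) hhT ((hχc.aestronglyMeasurable.mul
        (hGc.comp_aestronglyMeasurable hGu)).mul
        (hG'.comp_aestronglyMeasurable hGz)) (ae_of_all _ fun x => by
        simp only [Pi.mul_apply]
        rw [abs_mul, abs_mul]
        exact (mul_le_of_le_one_left (abs_nonneg _)
          (mul_le_one₀ (hχ1 _) (abs_nonneg _) (hG1 _))).trans (hGC _))).integrable_mul hDz
    have j3 : Integrable (fun x => h x * (χ x * deriv G (u x) * G (z x)) * Du i x)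
        (volume.restrict T) :=
      (memLp_mul_of_bound (C := C) hhT ((hχc.aestronglyMeasurable.mul
        (hG'.comp_aestronglyMeasurable hGu)).mul
        (hGc.comp_aestronglyMeasurable hGz)) (ae_of_all _ fun x => by
        simp only [Pi.mul_apply]
        rw [mul_right_comm, abs_mul, abs_mul]
        exact (mul_le_of_le_one_left (abs_nonneg _)
          (mul_le_one₀ (hχ1 _) (abs_nonneg _) (hG1 _))).trans (hGC _))).integrable_mul hDu
    have hlim := (t1.add t2).add t3
    have hleft : ∀ m, ∫ x in Ω, h x * partialDeriv i (v m) x =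
        ∫ x in T, h x * partialDeriv i (v m) x := fun m =>
      setIntegral_eq_of_subset_of_forall_sdiff_eq_zero hΩm hTΩ fun x hx => by
        rw [partialDeriv_eq_zero_of_notMem_tsupport i (fun h => hx.2 (hvt m h)), mul_zero]
    have hright : ∫ x in Ω, h x * gradProd G u z Du Dz i x =
        ∫ x in T, h x * gradProd G u z Du Dz i x :=
      setIntegral_eq_of_subset_of_forall_sdiff_eq_zero hΩm hTΩ fun x hx => by
        obtain ⟨h1, h2⟩ := hzS x ⟨hx.1, fun h => hx.2 (hST h)⟩
        simp [gradProd, h1, h2]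
    rw [hright]
    convert hlim using 1
    · ext m
      rw [hleft]
      refine Eq.trans ?_ (integral_add_add (i1 m) (i2 m) (i3 m))
      refine integral_congr_ae (ae_of_all _ fun x => ?_)
      simp only [hv]
      rw [partialDeriv_test_mul hχ.smooth (hU m) (hZ m) hG]
      ring
    · refine congrArg 𝓝 (Eq.trans ?_ (integral_add_add j1 j2 j3))
      refine integral_congr_ae ?_
      filter_upwards [ae_restrict_mem hTc.measurableSet] with x hx
      simp only [gradProd]
      -- The cutoff leaves no trace in the limit: on `S` it equals 1 with zero derivative, and off
      -- `S` both `G(z)` and `G'(z)` vanish.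
      by_cases hxS : x ∈ S
      · have h1 : χ x = 1 := (hχS x hxS).eq_of_nhds
        have h2 : partialDeriv i χ x = 0 := by simp [partialDeriv, (hχS x hxS).fderiv_eq]
        rw [h1, h2]
        ring
      · obtain ⟨h1, h2⟩ := hzS x ⟨hTΩ hx, hxS⟩
        simp [h1, h2]
  · have hfT : Integrable f (volume.restrict T) := hf.integrableOn_compact_subset hTΩ hTc
    have hleft : ∀ m, ∫ x in Ω, f x * v m x = ∫ x in T, f x * v m x := fun m =>
      setIntegral_eq_of_subset_of_forall_sdiff_eq_zero hΩm hTΩ fun x hx => by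
        rw [image_eq_zero_of_notMem_tsupport (fun h => hx.2 (hvt m h)), mul_zero]
    have hright : ∫ x in Ω, f x * (G (u x) * G (z x)) = ∫ x in T, f x * (G (u x) * G (z x)) :=
      setIntegral_eq_of_subset_of_forall_sdiff_eq_zero hΩm hTΩ fun x hx => by
        simp [(hzS x ⟨hx.1, fun h => hx.2 (hST h)⟩).1]
    simp_rw [hleft]
    rw [hright]
    -- Local integrability of `f` suffices: every product is bounded by 1 and supported in the one
    -- compact set `T`.
    refine tendsto_integral_of_dominated_convergence (fun x => ‖f x‖)
      (fun m => hfT.1.mul (hvtest m).smooth.continuous.aestronglyMeasurable) hfT.norm ?_ ?_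
    · refine fun m => ae_of_all _ fun x => ?_
      rw [norm_mul]
      refine mul_le_of_le_one_right (norm_nonneg _) ?_
      simp only [hv, Pi.mul_apply, Function.comp_apply, Real.norm_eq_abs, abs_mul]
      exact mul_le_one₀ (hχ1 _) (by positivity) (mul_le_one₀ (hG1 _) (abs_nonneg _) (hG1 _))
    · filter_upwards [hac hUt, hac hZt, ae_restrict_mem hTc.measurableSet] with x hx1 hx2 hxT
      have h1 : Tendsto (fun m => f x * v m x) atTop (𝓝 (f x * (χ x * (G (u x) * G (z x))))) :=
        ((((hGc.tendsto _).comp hx1).mul ((hGc.tendsto _).comp hx2)).const_mul _).const_mul _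
      convert h1 using 2
      by_cases hxS : x ∈ S
      · have h1 : χ x = 1 := (hχS x hxS).eq_of_nhds
        rw [h1, one_mul]
      · simp [(hzS x ⟨hTΩ hxT, hxS⟩).1]

/-- A smooth bounded nondecreasing function vanishing exactly on `(-∞, M]`. -/
theorem exists_smooth_ramp (M : ℝ) : ∃ G : ℝ → ℝ, ContDiff ℝ ∞ G ∧ (∀ t, 0 ≤ G t) ∧
    (∀ t, G t ≤ 1) ∧ (∀ t, t ≤ M → G t = 0 ∧ deriv G t = 0) ∧ (∀ t, M < t → 0 < G t) ∧
    (∀ t, 0 ≤ deriv G t) ∧ ∃ C, ∀ t, |deriv G t| ≤ C := by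
  have hsm : ContDiff ℝ ∞ Real.smoothTransition := Real.smoothTransition.contDiff
  -- Every `t ≤ 0` is a global minimum, so the endpoint `t = 0` needs no separate computation.
  have hd0 : ∀ t ≤ 0, deriv Real.smoothTransition t = 0 := fun t ht =>
    IsLocalMin.deriv_eq_zero (Eventually.of_forall fun s => by
      rw [Real.smoothTransition.zero_of_nonpos ht]; exact Real.smoothTransition.nonneg s)
  have hd1 : ∀ t, 1 ≤ t → deriv Real.smoothTransition t = 0 := fun t ht =>
    IsLocalMax.deriv_eq_zero (Eventually.of_forall fun s => by
      rw [Real.smoothTransition.one_of_one_le ht]; exact Real.smoothTransition.le_one s)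
  have hG' : ∀ t, deriv (fun t => Real.smoothTransition (t - M)) t
      = deriv Real.smoothTransition (t - M) := fun t => deriv_comp_sub_const _ _ _
  have hcomp : HasCompactSupport (deriv Real.smoothTransition) := by
    refine HasCompactSupport.intro (isCompact_Icc (a := (0 : ℝ)) (b := 1)) fun t ht => ?_
    rcases lt_or_ge t 0 with h | h
    · exact hd0 t h.le
    · exact hd1 t (not_lt.1 fun h' => ht ⟨h, h'.le⟩)
  obtain ⟨C, hC⟩ := hcomp.exists_bound_of_continuous (hsm.continuous_deriv (by simp))
  refine ⟨fun t => Real.smoothTransition (t - M), hsm.comp (contDiff_id.sub contDiff_const),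
    fun t => Real.smoothTransition.nonneg _, fun t => Real.smoothTransition.le_one _,
    fun t ht => ⟨Real.smoothTransition.zero_of_nonpos (by linarith), ?_⟩,
    fun t ht => Real.smoothTransition.pos_of_pos (by linarith), fun t => ?_, C, fun t => ?_⟩
  · rw [hG']; exact hd0 _ (by linarith)
  · rw [hG']; exact Real.smoothTransition.monotone.deriv_nonneg
  · rw [hG']; exact hC _

/-! ### A substitute for Poincaré's inequality, and uniqueness of weak gradients. -/

/-- Integration by parts against the coordinate `x i`, whose `i`-th derivative is 1. It shows that a
limit of test functions with vanishing gradient has zero integral. -/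
theorem IsTestFunction.integral_eq_neg_integral_coord_mul {N : ℕ} {Ω : Set (Euc N)} {v : Euc N → ℝ}
    (hv : IsTestFunction Ω v) (i : Fin N) :
    ∫ x in Ω, v x = - ∫ x in Ω, x i * partialDeriv i v x := by
  have hv0 : ∀ x, x ∉ Ω → v x = 0 := fun x hx =>
    image_eq_zero_of_notMem_tsupport fun h => hx (hv.support h)
  have hd0 : ∀ x, x ∉ tsupport v → partialDeriv i v x = 0 := fun x hx =>
    partialDeriv_eq_zero_of_notMem_tsupport i hx
  rw [setIntegral_eq_integral_of_forall_compl_eq_zero hv0,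
    setIntegral_eq_integral_of_forall_compl_eq_zero fun x hx => by
      rw [hd0 x fun h => hx (hv.support h), mul_zero]]
  have hc : ContDiff ℝ ∞ (fun x : Euc N => x i) := by fun_prop
  have hfd : ∀ x : Euc N, fderiv ℝ (fun x : Euc N => x i) x (EuclideanSpace.single i 1) = 1 := by
    intro x
    have : HasFDerivAt (fun x : Euc N => x i) (EuclideanSpace.proj i : Euc N →L[ℝ] ℝ) x :=
      (EuclideanSpace.proj (𝕜 := ℝ) i).hasFDerivAt
    rw [this.fderiv]
    simp
  have hcs : ∀ {g : Euc N → ℝ}, Continuous g → (∀ x, x ∉ tsupport v → g x = 0) →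
      Integrable g volume := fun hg h0 =>
    hg.integrable_of_hasCompactSupport (HasCompactSupport.intro hv.compact h0)
  have h := integral_mul_fderiv_eq_neg_fderiv_mul_of_integrable (μ := volume)
    (f := fun x : Euc N => x i) (g := v) (v := EuclideanSpace.single i 1)
    (hcs (by simp_rw [hfd]; exact continuous_const.mul hv.smooth.continuous) fun x hx => by
      rw [image_eq_zero_of_notMem_tsupport hx, mul_zero])
    (hcs (hc.continuous.mul (continuous_partialDeriv i hv.smooth)) fun x hx => by
      have := hd0 x hx
      rw [partialDeriv] at this
      rw [this, mul_zero])
    (hcs (hc.continuous.mul hv.smooth.continuous) fun x hx => by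
      rw [image_eq_zero_of_notMem_tsupport hx, mul_zero])
    (fun x _ => hc.differentiable (by simp) x) (fun x _ => hv.smooth.differentiable (by simp) x)
  simp_rw [hfd, one_mul] at h
  simp only [partialDeriv]
  rw [h, neg_neg]

/-- Uniqueness of weak derivatives. It reconciles the gradient of `u` in the equation with the one
coming from the boundary decomposition `u = w + u₀`. -/
theorem HasH1Gradient.ae_eq_add {N : ℕ} {Ω : Set (Euc N)} (hΩ : IsOpen Ω)
    (hΩb : Bornology.IsBounded Ω) {u w : Euc N → ℝ} {Du Dw D0 : Fin N → Euc N → ℝ}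
    (hu : HasH1Gradient Ω u Du) (hw : HasH1Gradient Ω w Dw)
    (h0 : HasH1Gradient Ω (fun x => u x - w x) D0) (i : Fin N) :
    ∀ᵐ x ∂volume.restrict Ω, Du i x = D0 i x + Dw i x := by
  have : IsFiniteMeasure (volume.restrict Ω) := ⟨by simpa using hΩb.measure_lt_top⟩
  have hL : MemLp (fun x => Du i x - D0 i x - Dw i x) 2 (volume.restrict Ω) :=
    ((hu.memLp_grad i).sub (h0.memLp_grad i)).sub (hw.memLp_grad i)
  have hloc : LocallyIntegrableOn (fun x => Du i x - D0 i x - Dw i x) Ω volume :=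
    IntegrableOn.locallyIntegrableOn (hL.integrable (by norm_num))
  have key := hΩ.ae_eq_zero_of_integral_contDiff_smul_eq_zero hloc fun g hg hgc hgΩ => by
    have hgt : IsTestFunction Ω g := ⟨hg, hgc, hgΩ⟩
    have hgL : MemLp g 2 (volume.restrict Ω) :=
      (hg.continuous.memLp_of_hasCompactSupport hgc).restrict Ω
    have hg'L : MemLp (partialDeriv i g) 2 (volume.restrict Ω) :=
      (hgt.memLp_partialDeriv i).restrict Ω
    rw [← setIntegral_eq_integral_of_forall_compl_eq_zero (s := Ω) fun x hx => by
      rw [image_eq_zero_of_notMem_tsupport fun h => hx (hgΩ h), zero_smul]]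
    have e1 := hu.weak i g hgt
    have e2 := hw.weak i g hgt
    have e3 := h0.weak i g hgt
    have s1 : ∫ x in Ω, (u x - w x) * partialDeriv i g x
        = (∫ x in Ω, u x * partialDeriv i g x) - ∫ x in Ω, w x * partialDeriv i g x := by
      refine Eq.trans ?_ (integral_sub (hu.memLp.integrable_mul hg'L)
        (hw.memLp.integrable_mul hg'L))
      exact integral_congr_ae (ae_of_all _ fun x => by simp [sub_mul])
    have s2 : ∫ x in Ω, g x • (Du i x - D0 i x - Dw i x) = (∫ x in Ω, Du i x * g x)
        - (∫ x in Ω, D0 i x * g x) - ∫ x in Ω, Dw i x * g x := by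
      have i1 := (hu.memLp_grad i).integrable_mul hgL
      have i2 := (h0.memLp_grad i).integrable_mul hgL
      have i3 := (hw.memLp_grad i).integrable_mul hgL
      refine Eq.trans ?_ ((integral_sub (i1.sub i2) i3).trans
        (congrArg (· - ∫ x in Ω, Dw i x * g x) (integral_sub i1 i2)))
      exact integral_congr_ae (ae_of_all _ fun x => by
        simp only [Pi.sub_apply, Pi.mul_apply, smul_eq_mul]; ring)
    rw [s2]
    linarith
  rw [ae_restrict_iff' hΩ.measurableSet]
  filter_upwards [key] with x hx hxΩ
  linarith [hx hxΩ]

theorem gradProd_integral_eq {N : ℕ} {μ : Measure (Euc N)} {u z : Euc N → ℝ}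
    {Du Dz : Fin N → Euc N → ℝ} {G : ℝ → ℝ} (hG : ContDiff ℝ ∞ G) (hG1 : ∀ t, |G t| ≤ 1) {C : ℝ}
    (hGC : ∀ t, |deriv G t| ≤ C) (hu : AEStronglyMeasurable u μ) (hz : AEStronglyMeasurable z μ)
    {i : Fin N} (hDu : MemLp (Du i) 2 μ) (hDz : MemLp (Dz i) 2 μ) {h : Euc N → ℝ}
    (hh : MemLp h 2 μ) :
    Integrable (fun x => h x * gradProd G u z Du Dz i x) μ ∧
    ∫ x, h x * gradProd G u z Du Dz i x ∂μ
      = ∫ x, h x * (G (u x) * deriv G (z x)) * Dz i x ∂μ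
        + ∫ x, h x * (deriv G (u x) * G (z x)) * Du i x ∂μ := by
  have hG' : Continuous (deriv G) := hG.continuous_deriv (by simp)
  have i1 : Integrable (fun x => h x * (G (u x) * deriv G (z x)) * Dz i x) μ :=
    (memLp_mul_of_bound (C := C) hh ((hG.continuous.comp_aestronglyMeasurable hu).mul
      (hG'.comp_aestronglyMeasurable hz)) (ae_of_all _ fun x => by
        rw [Pi.mul_apply, abs_mul]
        exact (mul_le_of_le_one_left (abs_nonneg _) (hG1 _)).trans (hGC _))).integrable_mul hDz
  have i2 : Integrable (fun x => h x * (deriv G (u x) * G (z x)) * Du i x) μ :=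
    (memLp_mul_of_bound (C := C) hh ((hG'.comp_aestronglyMeasurable hu).mul
      (hG.continuous.comp_aestronglyMeasurable hz)) (ae_of_all _ fun x => by
        rw [Pi.mul_apply, abs_mul]
        exact (mul_le_of_le_one_right (abs_nonneg _) (hG1 _)).trans (hGC _))).integrable_mul hDu
  have e : (fun x => h x * gradProd G u z Du Dz i x) = fun x =>
      h x * (G (u x) * deriv G (z x)) * Dz i x + h x * (deriv G (u x) * G (z x)) * Du i x := by
    ext x; simp only [gradProd]; ring
  rw [e]
  exact ⟨i1.add i2, integral_add i1 i2⟩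

/-- Each of the two terms of the product rule is an `L²` function times a bounded factor converging
almost everywhere times a factor converging in `L²`. -/
theorem tendsto_integral_gradProd {N : ℕ} {μ : Measure (Euc N)} {u : Euc N → ℝ}
    {z : ℕ → Euc N → ℝ} {Du : Fin N → Euc N → ℝ} {Dz : ℕ → Fin N → Euc N → ℝ} {G : ℝ → ℝ}
    (hG : ContDiff ℝ ∞ G) (hG1 : ∀ t, |G t| ≤ 1) {C : ℝ}
    (hGC : ∀ t, |deriv G t| ≤ C) (hu : AEStronglyMeasurable u μ)
    (hz : ∀ k, AEStronglyMeasurable (z k) μ)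
    (hzu : ∀ᵐ x ∂μ, Tendsto (fun k => z k x) atTop (𝓝 (u x))) {i : Fin N}
    (hDu : MemLp (Du i) 2 μ) (hDz : ∀ k, MemLp (Dz k i) 2 μ)
    (hDzu : Tendsto (fun k => eLpNorm (Du i - Dz k i) 2 μ) atTop (𝓝 0)) {h : Euc N → ℝ}
    (hh : MemLp h 2 μ) :
    Tendsto (fun k => ∫ x, h x * gradProd G u (z k) Du (Dz k) i x ∂μ) atTop
      (𝓝 (∫ x, h x * gradProd G u u Du Du i x ∂μ)) := by
  have hG' : Continuous (deriv G) := hG.continuous_deriv (by simp)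
  simp_rw [(gradProd_integral_eq hG hG1 hGC hu (hz _) hDu (hDz _) hh).2,
    (gradProd_integral_eq hG hG1 hGC hu hu hDu hDu hh).2]
  refine Tendsto.add ?_ ?_
  · refine tendsto_integral_mul_mul hh (C := C) (fun k =>
      (hG.continuous.comp_aestronglyMeasurable hu).mul (hG'.comp_aestronglyMeasurable (hz k)))
      (fun k => ae_of_all _ fun x => ?_) ?_ hDz hDu hDzu
    · rw [Pi.mul_apply, abs_mul]
      exact (mul_le_of_le_one_left (abs_nonneg _) (hG1 _)).trans (hGC _)
    · filter_upwards [hzu] with x hx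
      exact ((hG'.tendsto _).comp hx).const_mul _
  · refine tendsto_integral_mul_mul hh (C := C) (fun k =>
      (hG'.comp_aestronglyMeasurable hu).mul (hG.continuous.comp_aestronglyMeasurable (hz k)))
      (fun k => ae_of_all _ fun x => ?_) ?_ (fun _ => hDu) hDu (by simp)
    · rw [Pi.mul_apply, abs_mul]
      exact (mul_le_of_le_one_right (abs_nonneg _) (hG1 _)).trans (hGC _)
    · filter_upwards [hzu] with x hx
      exact ((hG.continuous.tendsto _).comp hx).const_mul _

/-! ### The weak maximum principle. -/

/-- The energy identity for the test function `G(u) G(z)`, where `G(z)` is supported in a compact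
subset of `Ω`. -/
theorem weak_equation_gradProd {N : ℕ} {Ω : Set (Euc N)} (hΩ : IsOpen Ω)
    {H : Fin N → Euc N → ℝ} (hH : ∀ i, MemLp (H i) 2 (volume.restrict Ω))
    {f : Euc N → ℝ} (hf : LocallyIntegrableOn f Ω volume)
    (heq : ∀ φ : Euc N → ℝ, IsTestFunction Ω φ →
      (∑ i, ∫ x in Ω, H i x * partialDeriv i φ x) + ∫ x in Ω, f x * φ x = 0)
    {X : Fin N → Euc N → ℝ} (hX : ∀ i, MemLp (X i) 2 (volume.restrict Ω))
    (hXi : ∀ i, ∀ x ∈ Ω, X i x = x i)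
    {u z : Euc N → ℝ} {Du Dz : Fin N → Euc N → ℝ} (hu : IsSmoothLimit Ω u Du)
    (hz : IsSmoothLimit Ω z Dz) {G : ℝ → ℝ} (hG : ContDiff ℝ ∞ G) (hG1 : ∀ t, |G t| ≤ 1) {C : ℝ}
    (hGC : ∀ t, |deriv G t| ≤ C) {S : Set (Euc N)} (hS : IsCompact S) (hSΩ : S ⊆ Ω)
    (hzS : ∀ x ∈ Ω \ S, G (z x) = 0 ∧ deriv G (z x) = 0) :
    (∑ i, ∫ x in Ω, H i x * gradProd G u z Du Dz i x)
        + ∫ x in Ω, f x * (G (u x) * G (z x)) = 0 ∧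
      ∀ i, ∫ x in Ω, G (u x) * G (z x) = -∫ x in Ω, X i x * gradProd G u z Du Dz i x := by
  obtain ⟨v, hv, hgrad, hval⟩ := exists_test_approx hΩ hu hz hG hG1 hGC hS hSΩ hzS
  constructor
  · have h1 := (tendsto_finsetSum Finset.univ fun i _ => hgrad i (H i) (hH i)).add (hval f hf)
    simp_rw [heq _ (hv _)] at h1
    exact tendsto_nhds_unique h1 tendsto_const_nhds
  · intro i
    have h1 := hval (fun _ => 1) ((locallyIntegrable_const 1).locallyIntegrableOn _)
    simp_rw [one_mul] at h1
    refine tendsto_nhds_unique h1 ((hgrad i (X i) (hX i)).neg.congr fun m => ?_)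
    rw [(hv m).integral_eq_neg_integral_coord_mul i]
    refine congrArg _ (setIntegral_congr_fun hΩ.measurableSet fun x hx => ?_)
    simp only [hXi i x hx]

/-- A weak subsolution that lies below `M` on the boundary, with a right-hand side of the right
sign where it exceeds `M`, lies below `M`. -/
theorem ae_le_of_weak_solution {N : ℕ} (hN : 0 < N) {Ω : Set (Euc N)} (hΩ : IsOpen Ω)
    (hΩb : Bornology.IsBounded Ω) {a : Fin N → Fin N → Euc N → ℝ}
    (ha : ∀ i j, ContinuousOn (a i j) (closure Ω)) {lam : ℝ} (hlam : 0 < lam)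
    (hell : ∀ x ∈ Ω, ∀ ξ : Euc N, lam * ‖ξ‖ ^ 2 ≤ ∑ i, ∑ j, a i j x * ξ i * ξ j)
    {u f w : Euc N → ℝ} {Du : Fin N → Euc N → ℝ} (hu : HasH1Gradient Ω u Du)
    (hf : LocallyIntegrableOn f Ω volume)
    (heq : ∀ φ : Euc N → ℝ, IsTestFunction Ω φ →
      (∫ x in Ω, ∑ i, ∑ j, a i j x * Du j x * partialDeriv i φ x)
        + ∫ x in Ω, f x * φ x = 0)
    (hw : MemH1 Ω w) (hwc : ContinuousOn w (closure Ω)) {M : ℝ} (hwM : ∀ x ∈ frontier Ω, w x < M)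
    (h0 : MemH10 Ω (fun x => u x - w x))
    (hfM : ∀ᵐ x ∂volume.restrict Ω, M < u x → 0 ≤ f x) :
    ∀ᵐ x ∂volume.restrict Ω, u x ≤ M := by
  have hfin : IsFiniteMeasure (volume.restrict Ω) := ⟨by simpa using hΩb.measure_lt_top⟩
  have hΩm := hΩ.measurableSet
  have hcl : IsCompact (closure Ω) := hΩb.isCompact_closure
  obtain ⟨Dw, hw⟩ := hw
  obtain ⟨D0, h0, φ, hφ, hφ0, hφD⟩ := h0
  obtain ⟨G, hG, hG0, hG1', hGM, hGpos, hGd, C, hGC⟩ := exists_smooth_ramp M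
  have hG1 : ∀ t, |G t| ≤ 1 := fun t => by rw [abs_of_nonneg (hG0 t)]; exact hG1' t
  have hDu := fun i => HasH1Gradient.ae_eq_add hΩ hΩb hu hw h0 i
  -- `L²` convergence gives almost everywhere convergence only along a subsequence.
  obtain ⟨ns, hns, hnst⟩ : ∃ ns : ℕ → ℕ, StrictMono ns ∧ ∀ᵐ x ∂volume.restrict Ω,
      Tendsto (fun k => φ (ns k) x) atTop (𝓝 (u x - w x)) := by
    refine TendstoInMeasure.exists_seq_tendsto_ae (tendstoInMeasure_of_tendsto_eLpNorm
      (p := 2) (by norm_num) (fun k => (hφ k).smooth.continuous.aestronglyMeasurable)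
      h0.memLp.1 (hφ0.congr fun k => ?_))
    rw [eLpNorm_sub_comm]
    rfl
  have hbdd : ∀ {g : Euc N → ℝ}, ContinuousOn g (closure Ω) →
      AEStronglyMeasurable g (volume.restrict Ω) ∧
        ∃ B, ∀ᵐ x ∂volume.restrict Ω, |g x| ≤ B := fun hg => by
    obtain ⟨B, hB⟩ := hcl.exists_bound_of_continuousOn hg
    refine ⟨(hg.mono subset_closure).aestronglyMeasurable hΩm, B, ?_⟩
    filter_upwards [ae_restrict_mem hΩm] with x hx
    exact hB x (subset_closure hx)
  set H : Fin N → Euc N → ℝ := fun i x => ∑ j, Du j x * a i j x with hHdef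
  have hH : ∀ i, MemLp (H i) 2 (volume.restrict Ω) := fun i =>
    memLp_finsetSum _ fun j _ => by
      obtain ⟨h1, B, hB⟩ := hbdd (ha i j)
      exact memLp_mul_of_bound (hu.memLp_grad j) h1 hB
  have hX : ∀ i : Fin N, MemLp (fun x : Euc N => x i) 2 (volume.restrict Ω) := fun i => by
    obtain ⟨h1, B, hB⟩ := hbdd (g := fun x : Euc N => x i)
      (Continuous.continuousOn (by fun_prop))
    exact MemLp.of_bound h1 B hB
  have heqH : ∀ ψ : Euc N → ℝ, IsTestFunction Ω ψ →
      (∑ i, ∫ x in Ω, H i x * partialDeriv i ψ x) + ∫ x in Ω, f x * ψ x = 0 := fun ψ hψ => by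
    rw [← heq ψ hψ]
    congr 1
    refine (integral_finsetSum _ fun i _ =>
      (hH i).integrable_mul ((hψ.memLp_partialDeriv i).restrict Ω)).symm.trans ?_
    refine integral_congr_ae (ae_of_all _ fun x => ?_)
    refine Finset.sum_congr rfl fun i _ => ?_
    simp only [hHdef, Pi.mul_apply, Finset.sum_mul]
    exact Finset.sum_congr rfl fun j _ => by ring
  have husl := hu.isSmoothLimit hΩ
  set z : ℕ → Euc N → ℝ := fun k => w + φ (ns k) with hzdef
  set Dz : ℕ → Fin N → Euc N → ℝ := fun k i => Dw i + partialDeriv i (φ (ns k)) with hDzdef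
  have hzsl : ∀ k, IsSmoothLimit Ω (z k) (Dz k) := fun k =>
    (hw.isSmoothLimit hΩ).add_test (hφ (ns k))
  have hweak : ∀ k, (∑ i, ∫ x in Ω, H i x * gradProd G u (z k) Du (Dz k) i x)
        + ∫ x in Ω, f x * (G (u x) * G (z k x)) = 0 ∧
      ∀ i : Fin N, ∫ x in Ω, G (u x) * G (z k x)
        = -∫ x in Ω, x i * gradProd G u (z k) Du (Dz k) i x := fun k => by
    have hK : IsCompact (closure Ω ∩ w ⁻¹' Ici M) :=
      hcl.of_isClosed_subset (hwc.preimage_isClosed_of_isClosed isClosed_closure isClosed_Ici)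
        inter_subset_left
    refine weak_equation_gradProd hΩ hH hf heqH hX (fun i x _ => rfl) husl (hzsl k) hG hG1 hGC
      (S := tsupport (φ (ns k)) ∪ (closure Ω ∩ w ⁻¹' Ici M))
      (IsCompact.union (hφ (ns k)).compact hK) (union_subset (hφ (ns k)).support ?_) ?_
    -- The strict inequality `w < M` on the frontier keeps the compact set `{w ≥ M}` inside `Ω`.
    · rintro x ⟨hx, hxM⟩
      by_contra hxΩ
      exact absurd (hwM x ⟨hx, by rwa [hΩ.interior_eq]⟩) (not_lt.2 hxM)
    · rintro x ⟨hxΩ, hxS⟩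
      refine hGM _ ?_
      rw [mem_union, not_or] at hxS
      have h1 : φ (ns k) x = 0 := image_eq_zero_of_notMem_tsupport hxS.1
      have h2 : w x < M := not_le.1 fun h => hxS.2 ⟨subset_closure hxΩ, h⟩
      simp only [hzdef, Pi.add_apply, h1, add_zero]
      exact h2.le
  have hum : AEStronglyMeasurable u (volume.restrict Ω) := hu.memLp.1
  have hzm : ∀ k, AEStronglyMeasurable (z k) (volume.restrict Ω) := fun k =>
    hw.memLp.1.add (hφ (ns k)).smooth.continuous.aestronglyMeasurable
  have hzu : ∀ᵐ x ∂volume.restrict Ω, Tendsto (fun k => z k x) atTop (𝓝 (u x)) := by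
    filter_upwards [hnst] with x hx
    have := hx.const_add (w x)
    rwa [add_sub_cancel] at this
  have hDzu : ∀ i, Tendsto (fun k => eLpNorm (Du i - Dz k i) 2 (volume.restrict Ω)) atTop
      (𝓝 0) := fun i => by
    refine ((hφD i).comp hns.tendsto_atTop).congr fun k => eLpNorm_congr_ae ?_
    filter_upwards [hDu i] with x hx
    simp only [hDzdef, Pi.sub_apply, Pi.add_apply, hx]
    ring
  have hlim : ∀ i, ∀ {h : Euc N → ℝ}, MemLp h 2 (volume.restrict Ω) →
      Tendsto (fun k => ∫ x in Ω, h x * gradProd G u (z k) Du (Dz k) i x) atTop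
        (𝓝 (∫ x in Ω, h x * gradProd G u u Du Du i x)) := fun i h hh =>
    tendsto_integral_gradProd hG hG1 hGC hum hzm hzu (hu.memLp_grad i)
      (fun k => (hzsl k).memLp_grad i) (hDzu i) hh
  have hle : ∑ i, ∫ x in Ω, H i x * gradProd G u u Du Du i x ≤ 0 := by
    refine le_of_tendsto (tendsto_finsetSum Finset.univ fun i _ => hlim i (hH i))
      (Eventually.of_forall fun k => ?_)
    -- The factor `G(u)` vanishes where the sign of `f` is unknown, so this term is discarded before
    -- `k → ∞` and its convergence is never needed.
    have h1 : 0 ≤ ∫ x in Ω, f x * (G (u x) * G (z k x)) := by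
      refine integral_nonneg_of_ae ?_
      filter_upwards [hfM] with x hx
      rcases le_or_gt (u x) M with h | h
      · simp [(hGM _ h).1]
      · exact mul_nonneg (hx h) (mul_nonneg (hG0 _) (hG0 _))
    linarith [(hweak k).1]
  have hgp : ∀ i x, gradProd G u u Du Du i x = 2 * (G (u x) * deriv G (u x)) * Du i x :=
    fun i x => by simp only [gradProd]; ring
  have hellx : ∀ x ∈ Ω, 2 * (G (u x) * deriv G (u x)) * (lam * ∑ i, Du i x ^ 2)
      ≤ ∑ i, H i x * gradProd G u u Du Du i x := fun x hx => by
    have h1 := hell x hx (WithLp.toLp 2 fun i => Du i x)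
    rw [EuclideanSpace.norm_sq_eq] at h1
    simp only [Real.norm_eq_abs, sq_abs] at h1
    refine (mul_le_mul_of_nonneg_left h1
      (mul_nonneg zero_le_two (mul_nonneg (hG0 _) (hGd _)))).trans_eq ?_
    simp only [hgp, hHdef, Finset.mul_sum, Finset.sum_mul]
    exact Finset.sum_congr rfl fun i _ => Finset.sum_congr rfl fun j _ => by ring
  have hpos : ∀ x, 0 ≤ 2 * (G (u x) * deriv G (u x)) * (lam * ∑ i, Du i x ^ 2) := fun x =>
    mul_nonneg (mul_nonneg zero_le_two (mul_nonneg (hG0 _) (hGd _)))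
      (mul_nonneg hlam.le (Finset.sum_nonneg fun i _ => sq_nonneg _))
  have hint : ∀ i, Integrable (fun x => H i x * gradProd G u u Du Du i x) (volume.restrict Ω) :=
    fun i => (gradProd_integral_eq hG hG1 hGC hum hum (hu.memLp_grad i) (hu.memLp_grad i) (hH i)).1
  have hnn : 0 ≤ᵐ[volume.restrict Ω] fun x => ∑ i, H i x * gradProd G u u Du Du i x := by
    filter_upwards [ae_restrict_mem hΩm] with x hx
    exact (hpos x).trans (hellx x hx)
  have hzero : ∀ᵐ x ∂volume.restrict Ω, ∀ i, gradProd G u u Du Du i x = 0 := by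
    have h1 : ∫ x in Ω, ∑ i, H i x * gradProd G u u Du Du i x = 0 := by
      refine le_antisymm ?_ (integral_nonneg_of_ae hnn)
      rwa [integral_finsetSum _ fun i _ => hint i]
    rw [integral_eq_zero_iff_of_nonneg_ae hnn (integrable_finsetSum _ fun i _ => hint i)] at h1
    filter_upwards [h1, ae_restrict_mem hΩm] with x hx hxΩ i
    have h2 : 2 * (G (u x) * deriv G (u x)) * (lam * ∑ i, Du i x ^ 2) = 0 :=
      le_antisymm ((hellx x hxΩ).trans_eq hx) (hpos x)
    rw [hgp]
    rcases mul_eq_zero.1 h2 with h3 | h3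
    · rw [h3, zero_mul]
    · have h4 := (Finset.sum_eq_zero_iff_of_nonneg fun i _ => sq_nonneg (Du i x)).1
        ((mul_eq_zero.1 h3).resolve_left hlam.ne') i (Finset.mem_univ i)
      rw [pow_eq_zero_iff two_ne_zero] at h4
      rw [h4, mul_zero]
  have hGm : AEStronglyMeasurable (fun x => G (u x)) (volume.restrict Ω) :=
    hG.continuous.comp_aestronglyMeasurable hum
  have hGL : MemLp (fun x => G (u x)) 2 (volume.restrict Ω) :=
    MemLp.of_bound hGm 1 (ae_of_all _ fun x => hG1 _)
  -- The coordinate identity for `G(u) G(z k)` passes to the limit, where its right side vanishes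
  -- with the gradient; any one coordinate will do.
  have hGG : ∫ x in Ω, G (u x) * G (u x) = 0 := by
    let i : Fin N := ⟨0, hN⟩
    have h1 : Tendsto (fun k => ∫ x in Ω, G (u x) * G (z k x)) atTop
        (𝓝 (∫ x in Ω, G (u x) * G (u x))) := by
      refine tendsto_integral_of_dominated_convergence (fun _ => 1)
        (fun k => hGm.mul (hG.continuous.comp_aestronglyMeasurable (hzm k)))
        (integrable_const 1) (fun k => ae_of_all _ fun x => ?_) ?_
      · rw [norm_mul]
        exact mul_le_one₀ (hG1 _) (norm_nonneg _) (hG1 _)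
      · filter_upwards [hzu] with x hx
        exact ((hG.continuous.tendsto _).comp hx).const_mul _
    have h2 := (hlim i (hX i)).neg
    have h3 : ∫ x in Ω, x i * gradProd G u u Du Du i x = 0 := by
      refine integral_eq_zero_of_ae ?_
      filter_upwards [hzero] with x hx
      simp [hx i]
    rw [h3, neg_zero] at h2
    exact tendsto_nhds_unique (h1.congr fun k => (hweak k).2 i) h2
  rw [integral_eq_zero_iff_of_nonneg (fun x => mul_nonneg (hG0 _) (hG0 _))
    (hGL.integrable_mul hGL)] at hGG
  filter_upwards [hGG] with x hx
  by_contra hxM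
  have := hGpos _ (not_le.1 hxM)
  exact (mul_pos this this).ne' hx

/-! ### Change of sign, and comparison with constants. -/

theorem IsTestFunction.neg {N : ℕ} {Ω : Set (Euc N)} {φ : Euc N → ℝ} (hφ : IsTestFunction Ω φ) :
    IsTestFunction Ω (fun x => -φ x) := by
  have h : tsupport (fun x => -φ x) = tsupport φ := by
    rw [tsupport, tsupport]
    congr 1
    ext x
    simp
  exact ⟨hφ.smooth.neg, by simpa [HasCompactSupport, h] using hφ.compact, h ▸ hφ.support⟩

theorem partialDeriv_neg {N : ℕ} (i : Fin N) (φ : Euc N → ℝ) (x : Euc N) :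
    partialDeriv i (fun x => -φ x) x = -partialDeriv i φ x := by
  have : fderiv ℝ (fun x => -φ x) x = -fderiv ℝ φ x := fderiv_neg
  simp [partialDeriv, this]

theorem HasH1Gradient.neg {N : ℕ} {Ω : Set (Euc N)} {u : Euc N → ℝ} {Du : Fin N → Euc N → ℝ}
    (h : HasH1Gradient Ω u Du) : HasH1Gradient Ω (fun x => -u x) (fun i x => -Du i x) :=
  ⟨h.memLp.neg, fun i => (h.memLp_grad i).neg, fun i φ hφ => by
    simp only [neg_mul, integral_neg, h.weak i φ hφ]⟩

theorem MemH10.neg {N : ℕ} {Ω : Set (Euc N)} {u : Euc N → ℝ} (h : MemH10 Ω u) :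
    MemH10 Ω (fun x => -u x) := by
  obtain ⟨Du, hu, φ, hφ, h0, hD⟩ := h
  refine ⟨_, hu.neg, fun k x => -φ k x, fun k => (hφ k).neg, h0.congr fun k => ?_,
    fun i => (hD i).congr fun k => ?_⟩
  · rw [← eLpNorm_neg]
    congr 1
    ext x
    simp only [Pi.neg_apply]
    ring
  · rw [← eLpNorm_neg]
    congr 1
    ext x
    simp only [Pi.neg_apply, partialDeriv_neg]
    ring

section Comparison

variable {N K : ℕ} {Ω : Set (Euc N)} {a : Fin N → Fin N → Euc N → ℝ} {b : Fin K → Euc N → ℝ}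
  {n : Fin K → ℤ} {ρ u : Euc N → ℝ} {lam M : ℝ}

theorem IsWeakSolution.ae_le (h : IsWeakSolution Ω a b n ρ u) (hN : 0 < N) (hΩ : IsOpen Ω)
    (hΩb : Bornology.IsBounded Ω) (ha : ∀ i j, ContinuousOn (a i j) (closure Ω)) (hlam : 0 < lam)
    (hell : ∀ x ∈ Ω, ∀ ξ : Euc N, lam * ‖ξ‖ ^ 2 ≤ ∑ i, ∑ j, a i j x * ξ i * ξ j)
    (hM : ∀ x ∈ frontier Ω, ρ x < M)
    (hf : ∀ᵐ x ∂volume.restrict Ω, M < u x → 0 ≤ ∑ i, b i x * u x ^ n i) :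
    ∀ᵐ x ∂volume.restrict Ω, u x ≤ M := by
  obtain ⟨Du, hu, heq⟩ := h.equation
  obtain ⟨w, hw, hwc, hwρ, h0⟩ := h.boundary
  exact ae_le_of_weak_solution hN hΩ hΩb ha hlam hell hu h.locallyIntegrable heq hw hwc
    (fun x hx => (hwρ x hx).trans_lt (hM x hx)) h0 hf

/-- The upper comparison applied to `-u`, `-f`, `-w` and `-M`. -/
theorem IsWeakSolution.ae_ge (h : IsWeakSolution Ω a b n ρ u) (hN : 0 < N) (hΩ : IsOpen Ω)
    (hΩb : Bornology.IsBounded Ω) (ha : ∀ i j, ContinuousOn (a i j) (closure Ω)) (hlam : 0 < lam)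
    (hell : ∀ x ∈ Ω, ∀ ξ : Euc N, lam * ‖ξ‖ ^ 2 ≤ ∑ i, ∑ j, a i j x * ξ i * ξ j)
    (hM : ∀ x ∈ frontier Ω, M < ρ x)
    (hf : ∀ᵐ x ∂volume.restrict Ω, u x < M → ∑ i, b i x * u x ^ n i ≤ 0) :
    ∀ᵐ x ∂volume.restrict Ω, M ≤ u x := by
  obtain ⟨Du, hu, heq⟩ := h.equation
  obtain ⟨w, ⟨Dw, hw⟩, hwc, hwρ, h0⟩ := h.boundary
  have key := ae_le_of_weak_solution (M := -M) hN hΩ hΩb ha hlam hell hu.neg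
    h.locallyIntegrable.neg (fun φ hφ => ?_) ⟨_, hw.neg⟩ hwc.neg
    (fun x hx => neg_lt_neg ((hM x hx).trans_eq (hwρ x hx).symm)) ?_ ?_
  · filter_upwards [key] with x hx
    exact neg_le_neg_iff.1 hx
  · have h1 := heq φ hφ
    simp only [mul_neg, neg_mul, Finset.sum_neg_distrib, integral_neg, Pi.neg_apply]
    linarith
  · convert h0.neg using 2
    ring
  · filter_upwards [hf] with x hx hxM
    simpa using hx (neg_lt_neg_iff.1 hxM)

/-- Rational `M` suffice, so only countably many null sets are discarded. -/
theorem ae_coe_le_of_forall_gt {α : Type*} {m : MeasurableSpace α} {μ : Measure α} {v : α → ℝ}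
    {B : EReal} (h : ∀ M : ℝ, B < M → ∀ᵐ x ∂μ, v x ≤ M) : ∀ᵐ x ∂μ, (v x : EReal) ≤ B := by
  have h1 : ∀ᵐ x ∂μ, ∀ q : ℚ, B < ((q : ℝ) : EReal) → v x ≤ q :=
    ae_all_iff.2 fun q => by
      by_cases hq : B < ((q : ℝ) : EReal)
      · filter_upwards [h q hq] with x hx _ using hx
      · exact ae_of_all _ fun x hx => absurd hx hq
  filter_upwards [h1] with x hx
  by_contra hlt
  obtain ⟨q, hq1, hq2⟩ := EReal.lt_iff_exists_rat_btwn.1 (not_le.1 hlt)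
  exact absurd (EReal.coe_le_coe_iff.2 (hx q hq1)) (not_le.2 hq2)

theorem ae_le_coe_of_forall_lt {α : Type*} {m : MeasurableSpace α} {μ : Measure α} {v : α → ℝ}
    {B : EReal} (h : ∀ M : ℝ, (M : EReal) < B → ∀ᵐ x ∂μ, M ≤ v x) :
    ∀ᵐ x ∂μ, B ≤ (v x : EReal) := by
  have h1 : ∀ᵐ x ∂μ, ∀ q : ℚ, ((q : ℝ) : EReal) < B → (q : ℝ) ≤ v x :=
    ae_all_iff.2 fun q => by
      by_cases hq : ((q : ℝ) : EReal) < B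
      · filter_upwards [h q hq] with x hx _ using hx
      · exact ae_of_all _ fun x hx => absurd hx hq
  filter_upwards [h1] with x hx
  by_contra hlt
  obtain ⟨q, hq1, hq2⟩ := EReal.lt_iff_exists_rat_btwn.1 (not_le.1 hlt)
  exact absurd (EReal.coe_le_coe_iff.2 (hx q hq2)) (not_le.2 hq1)

/-! ### Sign of the nonlinearity for extreme values of `y`. -/

theorem exists_abs_le_of_continuousOn (hcl : IsCompact (closure Ω))
    (hb : ∀ i, ContinuousOn (b i) (closure Ω)) :
    ∃ B, 0 ≤ B ∧ ∀ i, ∀ x ∈ closure Ω, |b i x| ≤ B := by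
  choose C hC using fun i => hcl.exists_bound_of_continuousOn (hb i)
  refine ⟨∑ i, |C i|, Finset.sum_nonneg fun i _ => abs_nonneg _, fun i x hx => ?_⟩
  exact ((hC i x hx).trans (le_abs_self _)).trans
    (Finset.single_le_sum (f := fun i => |C i|) (fun i _ => abs_nonneg _) (Finset.mem_univ i))

theorem exists_pos_le_of_continuousOn {g : Euc N → ℝ} (hcl : IsCompact (closure Ω))
    (hne : Ω.Nonempty) (hg : ContinuousOn g (closure Ω)) (hpos : ∀ x ∈ closure Ω, 0 < g x) :
    ∃ m, 0 < m ∧ ∀ x ∈ closure Ω, m ≤ g x := by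
  obtain ⟨x₀, hx₀, hmin⟩ := hcl.exists_isMinOn hne.closure hg
  exact ⟨g x₀, hpos x₀ hx₀, fun x hx => hmin hx⟩

theorem abs_mul_le_of_bound {B : ℝ} (hB : ∀ i, ∀ x ∈ closure Ω, |b i x| ≤ B) (y : ℝ) (i : Fin K)
    (x : closure Ω) : |b i x * y ^ n i| ≤ B * |y| ^ n i := by
  rw [abs_mul, abs_zpow]
  exact mul_le_mul_of_nonneg_right (hB i x x.2) (zpow_nonneg (abs_nonneg _) _)

/-- The coefficients are bounded on the compact closure, so each real infimum is a genuine lower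
bound. -/
theorem infSum_le (hcl : IsCompact (closure Ω)) (hb : ∀ i, ContinuousOn (b i) (closure Ω))
    {x : Euc N} (hx : x ∈ closure Ω) (y : ℝ) : infSum Ω b n y ≤ ∑ i, b i x * y ^ n i := by
  obtain ⟨B, -, hB⟩ := exists_abs_le_of_continuousOn hcl hb
  refine Finset.sum_le_sum fun i _ => ciInf_le (f := fun x : closure Ω => b i x * y ^ n i)
    ⟨-(B * |y| ^ n i), ?_⟩ ⟨x, hx⟩
  rintro _ ⟨x, rfl⟩
  exact (abs_le.1 (abs_mul_le_of_bound hB y i x)).1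

theorem le_supSum (hcl : IsCompact (closure Ω)) (hb : ∀ i, ContinuousOn (b i) (closure Ω))
    {x : Euc N} (hx : x ∈ closure Ω) (y : ℝ) : ∑ i, b i x * y ^ n i ≤ supSum Ω b n y := by
  obtain ⟨B, -, hB⟩ := exists_abs_le_of_continuousOn hcl hb
  refine Finset.sum_le_sum fun i _ => le_ciSup (f := fun x : closure Ω => b i x * y ^ n i)
    ⟨B * |y| ^ n i, ?_⟩ ⟨x, hx⟩
  rintro _ ⟨x, rfl⟩
  exact (abs_le.1 (abs_mul_le_of_bound hB y i x)).2

/-- A sum is positive when one of its terms dominates the others. -/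
theorem sum_pos_of_dominant {F : Fin K → ℝ} {k : Fin K} {m B t P : ℝ} (hP : 0 < P) (hB : 0 ≤ B)
    (hk : m * t * P ≤ F k) (hF : ∀ i, i ≠ k → -(B * P) ≤ F i) (ht : K * B < m * t) :
    0 < ∑ i, F i := by
  -- The dominant index is charged `-(B * P)` as well, so that the loss is exactly `K * B * P`.
  have h1 : ∑ i, (-(B * P) + if i = k then m * t * P else 0) ≤ ∑ i, F i := by
    refine Finset.sum_le_sum fun i _ => ?_
    by_cases hi : i = k
    · have := mul_nonneg hB hP.le
      subst hi
      rw [if_pos rfl]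
      linarith
    · rw [if_neg hi, add_zero]
      exact hF i hi
  rw [Finset.sum_add_distrib, Finset.sum_ite_eq' Finset.univ k] at h1
  simp only [Finset.sum_const, Finset.card_univ, Fintype.card_fin, nsmul_eq_mul,
    Finset.mem_univ, if_true] at h1
  have := mul_lt_mul_of_pos_right ht hP
  linarith

theorem exists_infSum_pos (hcl : IsCompact (closure Ω)) (hne : Ω.Nonempty)
    (hb : ∀ i, ContinuousOn (b i) (closure Ω)) {k : Fin K} (hk : ∀ i, i ≠ k → n i < n k)
    (hbk : ∀ x ∈ closure Ω, 0 < b k x) : ∃ c : ℝ, ∀ y ∈ Ioi c, 0 < infSum Ω b n y := by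
  obtain ⟨B, hB0, hB⟩ := exists_abs_le_of_continuousOn hcl hb
  obtain ⟨m, hm, hmb⟩ := exists_pos_le_of_continuousOn hcl hne (hb k) hbk
  have : Nonempty (closure Ω) := hne.closure.to_subtype
  -- Beyond 1 powers increase with the exponent, so the other terms are at most `B * y ^ (n k - 1)`;
  -- beyond `K * B / m` the extra factor `y` in the leading term outweighs all of them.
  refine ⟨max 1 (K * B / m), fun y hy => ?_⟩
  obtain ⟨hy1, hy2⟩ := max_lt_iff.1 (mem_Ioi.1 hy)
  have hy0 : 0 < y := one_pos.trans hy1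
  refine sum_pos_of_dominant (k := k) (m := m) (B := B) (t := y) (P := y ^ (n k - 1))
    (zpow_pos hy0 _) hB0 (le_ciInf fun x => ?_) (fun i hi => le_ciInf fun x => ?_) ?_
  · rw [mul_assoc, ← zpow_one_add₀ hy0.ne', add_sub_cancel]
    exact mul_le_mul_of_nonneg_right (hmb x x.2) (zpow_pos hy0 _).le
  · refine le_trans (neg_le_neg ?_) (abs_le.1 (abs_mul_le_of_bound hB y i x)).1
    rw [abs_of_pos hy0]
    exact mul_le_mul_of_nonneg_left
      (zpow_le_zpow_right₀ hy1.le (Int.le_sub_one_of_lt (hk i hi))) hB0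
  · rwa [div_lt_iff₀' hm] at hy2

theorem exists_supSum_neg_of_small (hcl : IsCompact (closure Ω)) (hne : Ω.Nonempty)
    (hb : ∀ i, ContinuousOn (b i) (closure Ω)) {k : Fin K} (hk : ∀ i, i ≠ k → n k < n i)
    (hbk : ∀ x ∈ closure Ω, b k x < 0) :
    ∃ c : ℝ, 0 < c ∧ ∀ y ∈ Ioo 0 c, supSum Ω b n y < 0 := by
  obtain ⟨B, hB0, hB⟩ := exists_abs_le_of_continuousOn hcl hb
  obtain ⟨m, hm, hmb⟩ := exists_pos_le_of_continuousOn (g := fun x => -b k x) hcl hne (hb k).neg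
    fun x hx => neg_pos.2 (hbk x hx)
  have : Nonempty (closure Ω) := hne.closure.to_subtype
  -- Below 1 the smallest exponent dominates, with gain `y⁻¹` over `y ^ (n k + 1)`. The `+ 1` keeps
  -- the denominator positive when `B = 0`.
  refine ⟨min 1 (m / (K * B + 1)), lt_min one_pos (by positivity), fun y hy => ?_⟩
  obtain ⟨hy1, hy2⟩ := lt_min_iff.1 hy.2
  have hy0 : 0 < y := hy.1
  rw [← neg_pos, supSum, ← Finset.sum_neg_distrib]
  refine sum_pos_of_dominant (k := k) (m := m) (B := B) (t := y⁻¹) (P := y ^ (n k + 1))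
    (zpow_pos hy0 _) hB0 (le_neg_of_le_neg (ciSup_le fun x => ?_))
    (fun i hi => neg_le_neg (ciSup_le fun x => ?_)) ?_
  · rw [mul_assoc, ← zpow_neg_one, ← zpow_add₀ hy0.ne', neg_add_cancel_comm_assoc]
    have := mul_le_mul_of_nonneg_right (hmb x x.2) (zpow_pos hy0 (n k)).le
    linarith
  · refine (abs_le.1 (abs_mul_le_of_bound hB y i x)).2.trans ?_
    rw [abs_of_pos hy0]
    exact mul_le_mul_of_nonneg_left
      (zpow_le_zpow_right_of_le_one₀ hy0 hy1.le (Int.add_one_le_of_lt (hk i hi))) hB0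
  · rw [lt_div_iff₀ (by positivity)] at hy2
    rw [← div_eq_mul_inv, lt_div_iff₀ hy0]
    linarith

theorem exists_supSum_neg_of_odd (hcl : IsCompact (closure Ω)) (hne : Ω.Nonempty)
    (hb : ∀ i, ContinuousOn (b i) (closure Ω)) {k : Fin K} (hk : ∀ i, i ≠ k → n i < n k)
    (hbk : ∀ x ∈ closure Ω, 0 < b k x) (hodd : Odd (n k)) :
    ∃ c : ℝ, ∀ y ∈ Iio c, supSum Ω b n y < 0 := by
  obtain ⟨B, hB0, hB⟩ := exists_abs_le_of_continuousOn hcl hb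
  obtain ⟨m, hm, hmb⟩ := exists_pos_le_of_continuousOn hcl hne (hb k) hbk
  have : Nonempty (closure Ω) := hne.closure.to_subtype
  refine ⟨-max 1 (K * B / m), fun y hy => ?_⟩
  obtain ⟨hy1, hy2⟩ := max_lt_iff.1 (lt_neg_of_lt_neg (mem_Iio.1 hy))
  have hy0 : 0 < -y := one_pos.trans hy1
  rw [← neg_pos, supSum, ← Finset.sum_neg_distrib]
  -- The comparison is made in powers of `|y| = -y`; oddness of `n k` makes the leading term
  -- negative.
  refine sum_pos_of_dominant (k := k) (m := m) (B := B) (t := -y) (P := (-y) ^ (n k - 1))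
    (zpow_pos hy0 _) hB0 (le_neg_of_le_neg (ciSup_le fun x => ?_))
    (fun i hi => neg_le_neg (ciSup_le fun x => ?_)) ?_
  · rw [mul_assoc, ← zpow_one_add₀ hy0.ne', add_sub_cancel]
    have h1 := mul_le_mul_of_nonneg_right (hmb x x.2) (zpow_pos hy0 (n k)).le
    have h2 : y ^ n k = -(-y) ^ n k := by rw [hodd.neg_zpow, neg_neg]
    rw [h2]
    linarith
  · refine (abs_le.1 (abs_mul_le_of_bound hB y i x)).2.trans ?_
    rw [abs_of_neg (neg_pos.1 hy0)]
    exact mul_le_mul_of_nonneg_left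
      (zpow_le_zpow_right₀ hy1.le (Int.le_sub_one_of_lt (hk i hi))) hB0
  · rwa [div_lt_iff₀' hm] at hy2

/-! ### The bounds `α₁`, `α₂` and `β`. -/

theorem betaBound_lt_top (hcl : IsCompact (closure Ω)) (hne : Ω.Nonempty)
    (hb : ∀ i, ContinuousOn (b i) (closure Ω)) (hρ : ContinuousOn ρ (closure Ω)) {k : Fin K}
    (hk : ∀ i, i ≠ k → n i < n k) (hbk : ∀ x ∈ closure Ω, 0 < b k x) :
    betaBound Ω b n ρ < ⊤ := by
  obtain ⟨c, hc⟩ := exists_infSum_pos hcl hne hb hk hbk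
  obtain ⟨R, hR⟩ := hcl.exists_bound_of_continuousOn hρ
  refine max_lt ((iInf₂_le c hc).trans_lt (EReal.coe_lt_top c)) (lt_of_le_of_lt
    (iSup₂_le fun x hx => EReal.coe_le_coe_iff.2 ?_) (EReal.coe_lt_top R))
  exact (le_abs_self _).trans (hR x (frontier_subset_closure hx))

theorem IsWeakSolution.ae_le_betaBound (h : IsWeakSolution Ω a b n ρ u) (hN : 0 < N)
    (hΩ : IsOpen Ω) (hΩb : Bornology.IsBounded Ω)
    (ha : ∀ i j, ContinuousOn (a i j) (closure Ω)) (hb : ∀ i, ContinuousOn (b i) (closure Ω))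
    (hlam : 0 < lam)
    (hell : ∀ x ∈ Ω, ∀ ξ : Euc N, lam * ‖ξ‖ ^ 2 ≤ ∑ i, ∑ j, a i j x * ξ i * ξ j) :
    ∀ᵐ x ∂volume.restrict Ω, (u x : EReal) ≤ betaBound Ω b n ρ := by
  refine ae_coe_le_of_forall_gt fun M hM => ?_
  obtain ⟨hM1, hM2⟩ := max_lt_iff.1 hM
  simp only [betaBound', iInf_lt_iff] at hM1
  obtain ⟨c, hc, hcM⟩ := hM1
  refine h.ae_le hN hΩ hΩb ha hlam hell (fun x hx => EReal.coe_lt_coe_iff.1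
    ((le_iSup₂ (f := fun x (_ : x ∈ frontier Ω) => (ρ x : EReal)) x hx).trans_lt hM2)) ?_
  filter_upwards [ae_restrict_mem hΩ.measurableSet] with x hx hxM
  exact (hc (u x) ((EReal.coe_lt_coe_iff.1 hcM).trans hxM)).le.trans
    (infSum_le hΩb.isCompact_closure hb (subset_closure hx) _)

theorem alphaOne_pos (hcl : IsCompact (closure Ω)) (hne : Ω.Nonempty)
    (hb : ∀ i, ContinuousOn (b i) (closure Ω)) (hρ : ContinuousOn ρ (closure Ω))
    (hρ_pos : ∀ x ∈ closure Ω, 0 < ρ x) {k : Fin K} (hk : ∀ i, i ≠ k → n k < n i)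
    (hbk : ∀ x ∈ closure Ω, b k x < 0) : 0 < alphaOne Ω b n ρ := by
  obtain ⟨c, hc0, hc⟩ := exists_supSum_neg_of_small hcl hne hb hk hbk
  obtain ⟨r, hr, hrρ⟩ := exists_pos_le_of_continuousOn hcl hne hρ hρ_pos
  refine lt_min ((EReal.coe_lt_coe_iff.2 hc0).trans_le
    (le_iSup₂ (f := fun (c : ℝ) (_ : c ∈ {c : ℝ | 0 < c ∧ ∀ y ∈ Ioo 0 c, supSum Ω b n y < 0}) =>
      (c : EReal)) c ⟨hc0, hc⟩)) ((EReal.coe_lt_coe_iff.2 hr).trans_le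
    (le_iInf₂ fun x hx => EReal.coe_le_coe_iff.2 (hrρ x (frontier_subset_closure hx))))

theorem IsWeakSolution.alphaOne_ae_le (h : IsWeakSolution Ω a b n ρ u) (hN : 0 < N)
    (hΩ : IsOpen Ω) (hΩb : Bornology.IsBounded Ω)
    (ha : ∀ i j, ContinuousOn (a i j) (closure Ω)) (hb : ∀ i, ContinuousOn (b i) (closure Ω))
    (hlam : 0 < lam)
    (hell : ∀ x ∈ Ω, ∀ ξ : Euc N, lam * ‖ξ‖ ^ 2 ≤ ∑ i, ∑ j, a i j x * ξ i * ξ j)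
    (hu : ∀ᵐ x ∂volume.restrict Ω, 0 < u x) :
    ∀ᵐ x ∂volume.restrict Ω, alphaOne Ω b n ρ ≤ (u x : EReal) := by
  refine ae_le_coe_of_forall_lt fun M hM => ?_
  obtain ⟨hM1, hM2⟩ := lt_min_iff.1 hM
  obtain ⟨c, hc, hcM⟩ := lt_biSup_iff.1 hM1
  refine h.ae_ge hN hΩ hΩb ha hlam hell (fun x hx => EReal.coe_lt_coe_iff.1
    (hM2.trans_le (iInf₂_le (f := fun x (_ : x ∈ frontier Ω) => (ρ x : EReal)) x hx))) ?_
  -- The sign condition defining `alphaOne'` covers only `(0, c)`; positivity of `u` places its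
  -- values there.
  filter_upwards [ae_restrict_mem hΩ.measurableSet, hu] with x hx hx0 hxM
  exact (le_supSum hΩb.isCompact_closure hb (subset_closure hx) _).trans
    (hc.2 (u x) ⟨hx0, hxM.trans (EReal.coe_lt_coe_iff.1 hcM)⟩).le

theorem bot_lt_alphaTwo (hcl : IsCompact (closure Ω)) (hne : Ω.Nonempty)
    (hb : ∀ i, ContinuousOn (b i) (closure Ω)) (hρ : ContinuousOn ρ (closure Ω)) {k : Fin K}
    (hk : ∀ i, i ≠ k → n i < n k) (hbk : ∀ x ∈ closure Ω, 0 < b k x) (hodd : Odd (n k)) :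
    ⊥ < alphaTwo Ω b n ρ := by
  obtain ⟨c, hc⟩ := exists_supSum_neg_of_odd hcl hne hb hk hbk hodd
  obtain ⟨R, hR⟩ := hcl.exists_bound_of_continuousOn hρ
  refine lt_min ((EReal.bot_lt_coe c).trans_le
    (le_iSup₂ (f := fun (c : ℝ) (_ : c ∈ {c : ℝ | ∀ y ∈ Iio c, supSum Ω b n y < 0}) =>
      (c : EReal)) c hc)) ((EReal.bot_lt_coe (-R)).trans_le
    (le_iInf₂ fun x hx => EReal.coe_le_coe_iff.2 ?_))
  exact (abs_le.1 (hR x (frontier_subset_closure hx))).1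

theorem IsWeakSolution.alphaTwo_ae_le (h : IsWeakSolution Ω a b n ρ u) (hN : 0 < N)
    (hΩ : IsOpen Ω) (hΩb : Bornology.IsBounded Ω)
    (ha : ∀ i j, ContinuousOn (a i j) (closure Ω)) (hb : ∀ i, ContinuousOn (b i) (closure Ω))
    (hlam : 0 < lam)
    (hell : ∀ x ∈ Ω, ∀ ξ : Euc N, lam * ‖ξ‖ ^ 2 ≤ ∑ i, ∑ j, a i j x * ξ i * ξ j) :
    ∀ᵐ x ∂volume.restrict Ω, alphaTwo Ω b n ρ ≤ (u x : EReal) := by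
  refine ae_le_coe_of_forall_lt fun M hM => ?_
  obtain ⟨hM1, hM2⟩ := lt_min_iff.1 hM
  obtain ⟨c, hc, hcM⟩ := lt_biSup_iff.1 hM1
  refine h.ae_ge hN hΩ hΩb ha hlam hell (fun x hx => EReal.coe_lt_coe_iff.1
    (hM2.trans_le (iInf₂_le (f := fun x (_ : x ∈ frontier Ω) => (ρ x : EReal)) x hx))) ?_
  filter_upwards [ae_restrict_mem hΩ.measurableSet] with x hx hxM
  exact (le_supSum hΩb.isCompact_closure hb (subset_closure hx) _).trans
    (hc (u x) (hxM.trans (EReal.coe_lt_coe_iff.1 hcM))).le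

end Comparison

end SemilinearDirichlet

theorem proposition5p1 {N K : ℕ} (hN : 0 < N) (Ω : Set (SemilinearDirichlet.Euc N))
    (hΩ_open : IsOpen Ω) (hΩ_bdd : Bornology.IsBounded Ω) (hΩ_ne : Ω.Nonempty)
    (a : Fin N → Fin N → SemilinearDirichlet.Euc N → ℝ)
    (b : Fin K → SemilinearDirichlet.Euc N → ℝ) (n : Fin K → ℤ)
    (ρ : SemilinearDirichlet.Euc N → ℝ)
    (ha : ∀ i j, ContinuousOn (a i j) (closure Ω))
    (hb : ∀ i, ContinuousOn (b i) (closure Ω))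
    (hρ : ContinuousOn ρ (closure Ω)) (hρ_pos : ∀ x ∈ closure Ω, 0 < ρ x)
    (lam : ℝ) (hlam : 0 < lam)
    (hell : ∀ x ∈ Ω, ∀ ξ : SemilinearDirichlet.Euc N,
      lam * ‖ξ‖ ^ 2 ≤ ∑ i, ∑ j, a i j x * ξ i * ξ j)
    (top : Fin K) (htop_pos : 0 < n top) (htop_max : ∀ i, i ≠ top → n i < n top)
    (hb_top : ∀ x ∈ closure Ω, 0 < b top x) :
    (∀ bot : Fin K, n bot < 0 → (∀ i, i ≠ bot → n bot < n i) →
      (∀ x ∈ closure Ω, b bot x < 0) →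
      0 < SemilinearDirichlet.alphaOne Ω b n ρ ∧
      SemilinearDirichlet.betaBound Ω b n ρ < ⊤ ∧
      ∀ u : SemilinearDirichlet.Euc N → ℝ,
        SemilinearDirichlet.IsWeakSolution Ω a b n ρ u →
        (∀ᵐ x ∂(MeasureTheory.volume.restrict Ω), 0 < u x) →
        ∀ᵐ x ∂(MeasureTheory.volume.restrict Ω),
          SemilinearDirichlet.alphaOne Ω b n ρ ≤ (u x : EReal) ∧
          (u x : EReal) ≤ SemilinearDirichlet.betaBound Ω b n ρ) ∧
    (Odd (n top) → (∀ i, 0 < n i) →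
      ⊥ < SemilinearDirichlet.alphaTwo Ω b n ρ ∧
      SemilinearDirichlet.betaBound Ω b n ρ < ⊤ ∧
      ∀ u : SemilinearDirichlet.Euc N → ℝ,
        SemilinearDirichlet.IsWeakSolution Ω a b n ρ u →
        ∀ᵐ x ∂(MeasureTheory.volume.restrict Ω),
          SemilinearDirichlet.alphaTwo Ω b n ρ ≤ (u x : EReal) ∧
          (u x : EReal) ≤ SemilinearDirichlet.betaBound Ω b n ρ) := by
  have hcl := hΩ_bdd.isCompact_closure
  have hβ := SemilinearDirichlet.betaBound_lt_top hcl hΩ_ne hb hρ htop_max hb_top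
  refine ⟨fun bot _ hbot_min hb_bot =>
    ⟨SemilinearDirichlet.alphaOne_pos hcl hΩ_ne hb hρ hρ_pos hbot_min hb_bot, hβ,
      fun u hu hu_pos => ?_⟩, fun hodd _ =>
    ⟨SemilinearDirichlet.bot_lt_alphaTwo hcl hΩ_ne hb hρ htop_max hb_top hodd, hβ,
      fun u hu => ?_⟩⟩
  · filter_upwards [hu.alphaOne_ae_le hN hΩ_open hΩ_bdd ha hb hlam hell hu_pos,
      hu.ae_le_betaBound hN hΩ_open hΩ_bdd ha hb hlam hell] with x h1 h2 using ⟨h1, h2⟩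
  · filter_upwards [hu.alphaTwo_ae_le hN hΩ_open hΩ_bdd ha hb hlam hell,
      hu.ae_le_betaBound hN hΩ_open hΩ_bdd ha hb hlam hell] with x h1 h2 using ⟨h1, h2⟩
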